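/- Let $(\mathcal B_a)_{a\in\mathbb R}$ be a scale of real Banach spaces with consistent continuous embeddings $\mathcal B_b\hookrightarrow\mathcal B_a$ for $a\le b$, satisfying the interpolation inequality $\|x\|_{a_2}^{a_3-a_1}\le C\,\|x\|_{a_1}^{a_3-a_2}\|x\|_{a_3}^{a_2-a_1}$ for $a_1\le a_2\le a_3$ and $x\in\mathcal B_{a_3}$, with $C=C(a_1,a_2,a_3)$. Let $\mathcal E$ be a linear operator such that, consistently for all $a\in\mathbb R$, $-\mathcal E$ with domain $\mathcal B_{a+1}$ (with the graph norm) generates an analytic strongly continuous semigroup $S_t=e^{-t\mathcal E}$, $t\ge 0$, on $\mathcal B_a$. Let $W^H=(W^H_t)_{t\ge0}$ be a real fractional Brownian motion with Hurst parameter $H\in(\tfrac12,1)$ on a probability space, i.e. a centred Gaussian process with almost surely continuous paths and covariance $\tfrac12(s^{2H}+t^{2H}-|t-s|^{2H})$. Let $\gamma\in(\tfrac12,H)$, $\beta\in[0,1)$, $\theta\in[0,\gamma)$ and $\alpha>\theta+\gamma$. Assume: 1. (drift) $\mathcal D:\mathcal B_\alpha\to\mathcal B_{\alpha-\beta}$,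 and there are constants $C,p,q\ge0$ such that, for all $x,y\in\mathcal B_\alpha$, $\|\mathcal Dx\|_{\alpha-\beta}\le C\|x\|_\alpha^q$ and $\|\mathcal Dx-\mathcal Dy\|_{\alpha-\beta}\le C\max(\|x\|_\alpha^p,\|y\|_\alpha^p)\,\|x-y\|_\alpha$. 2. (noise coefficient) $\mathcal F$ is a map $\mathcal B_{\alpha-\gamma}\to\mathcal B_{\alpha-\gamma-\theta}$ whose restriction to $\mathcal B_\alpha$ is a map $\mathcal B_\alpha\to\mathcal B_{\alpha-\theta}$; both maps are twice Fréchet differentiable with bounded first and second derivatives, and there is a constant $C$ such that $\|\mathcal Fx\|_{\alpha-\theta}\le C\|x\|_\alpha$ and $\|\mathcal Fx-\mathcal Fy\|_{\alpha-\theta}\le C\|x-y\|_\alpha$ for all $x,y\in\mathcal B_\alpha$. For $T>0$ let $V^T=C([0,T];\mathcal B_\alpha)\cap C^\gamma([0,T];\mathcal B_{\alpha-\gamma})$. Then, almost surely, for every $\omega_0\in\mathcal B_\alpha$ there is $T_0>0$ (depending on $\omega_0$ and on the path of $W^H$) such that for every $T\in(0,T_0]$ the equation $d\omega_t+(\mathcal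 D+\mathcal E)\omega_t\,dt+\mathcal F\omega_t\,dW^H_t=0$ with initial value $\omega_0$ has exactly one mild solution in $V^T$, i.e. there is exactly one $\omega\in V^T$ such that, for all $t\in[0,T]$, $$\omega_t=S_t\omega_0-\int_0^tS_{t-s}(\mathcal D\omega_s)\,ds-\int_0^tS_{t-s}(\mathcal F\omega_s)\,dW^H_s\quad\text{in }\mathcal B_\alpha .$$ Here the first integral is an (existing) Bochner integral in $\mathcal B_\alpha$, and the second one is the pathwise Young integral, i.e. the (existing) limit in $\mathcal B_\alpha$, as $k\to\infty$, of the dyadic Riemann sums $$\sum_{[\frac n{2^k},\frac{n+1}{2^k}]\subset[0,t]}S_{t-\frac n{2^k}}(\mathcal F\omega_{\frac n{2^k}})\,\bigl(W^H_{\frac{n+1}{2^k}}-W^H_{\frac n{2^k}}\bigr).$$ -/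

import Mathlib

open MeasureTheory ProbabilityTheory Filter Topology Set
open scoped NNReal

/-- A family `(B_a)`, `a ∈ ℝ`, of Banach spaces with continuous embeddings `B_b ↪ B_a` for `a ≤ b`
(consistent with each other) that satisfies the interpolation inequality
`‖x‖_{a₂}^{a₃-a₁} ≤ C ‖x‖_{a₁}^{a₃-a₂} ‖x‖_{a₃}^{a₂-a₁}` for `a₁ ≤ a₂ ≤ a₃`, `x ∈ B_{a₃}`. -/
structure InterpolationScale (B : ℝ → Type*) [∀ a, NormedAddCommGroup (B a)]
    [∀ a, NormedSpace ℝ (B a)] where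
  /-- the embedding `B_b ↪ B_a`, `a ≤ b` -/
  emb : ∀ {a b : ℝ}, a ≤ b → (B b →L[ℝ] B a)
  emb_injective : ∀ {a b : ℝ} (h : a ≤ b), Function.Injective (emb h)
  emb_refl : ∀ (a : ℝ) (x : B a), emb le_rfl x = x
  emb_comp : ∀ {a b c : ℝ} (hab : a ≤ b) (hbc : b ≤ c) (x : B c),
    emb hab (emb hbc x) = emb (hab.trans hbc) x
  interpolation : ∀ {a₁ a₂ a₃ : ℝ} (h₁₂ : a₁ ≤ a₂) (h₂₃ : a₂ ≤ a₃), ∃ C : ℝ, ∀ x : B a₃,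
    ‖emb h₂₃ x‖ ^ (a₃ - a₁) ≤
      C * (‖emb (h₁₂.trans h₂₃) x‖ ^ (a₃ - a₂) * ‖x‖ ^ (a₂ - a₁))

/-- A strongly continuous semigroup `(S_t)_{t ≥ 0}` of bounded operators on a Banach space
(the values at negative times are irrelevant). -/
structure IsC0Semigroup {X : Type*} [NormedAddCommGroup X] [NormedSpace ℝ X]
    (S : ℝ → X →L[ℝ] X) : Prop where
  zero : S 0 = ContinuousLinearMap.id ℝ X
  add : ∀ s t : ℝ, 0 ≤ s → 0 ≤ t → S (s + t) = (S s).comp (S t)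
  strongly_continuous : ∀ x : X, Tendsto (fun t : ℝ => S t x) (𝓝[>] 0) (𝓝 x)

/-- An analytic semigroup on a real Banach space `X`: a strongly continuous semigroup such that
`t ↦ S_t`, `t > 0`, extends to a holomorphic function `z ↦ P_z + i Q_z` on an open sector around
the positive half-line, with values in the bounded operators on the complexification of `X`,
bounded near the vertex. Here `P_z, Q_z` are real bounded operators on `X`, and holomorphy is
written as real differentiability together with the Cauchy-Riemann equations: the derivative
at `z` is `h ↦ h (P' + i Q')`. -/
structure IsAnalyticSemigroup {X : Type*} [NormedAddCommGroup X] [NormedSpace ℝ X]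
    (S : ℝ → X →L[ℝ] X) : Prop extends IsC0Semigroup S where
  exists_extension : ∃ δ : ℝ, 0 < δ ∧ δ ≤ Real.pi / 2 ∧ ∃ P Q : ℂ → X →L[ℝ] X,
    (∀ t : ℝ, 0 < t → P (t : ℂ) = S t ∧ Q (t : ℂ) = 0) ∧
    (∀ z : ℂ, z ≠ 0 → |z.arg| < δ → ∃ P' Q' : X →L[ℝ] X,
      HasFDerivAt P (Complex.reCLM.smulRight P' - Complex.imCLM.smulRight Q') z ∧
      HasFDerivAt Q (Complex.reCLM.smulRight Q' + Complex.imCLM.smulRight P') z) ∧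
    (∃ M : ℝ, ∀ z : ℂ, z ≠ 0 → |z.arg| < δ → ‖z‖ ≤ 1 → ‖P z‖ ≤ M ∧ ‖Q z‖ ≤ M)

/-- A map between normed spaces that is twice Fréchet differentiable with bounded first and second
derivatives. -/
def IsTwiceDiffBounded {X Y : Type*} [NormedAddCommGroup X] [NormedSpace ℝ X]
    [NormedAddCommGroup Y] [NormedSpace ℝ Y] (f : X → Y) : Prop :=
  Differentiable ℝ f ∧ Differentiable ℝ (fderiv ℝ f) ∧
    ∃ C : ℝ, ∀ x, ‖fderiv ℝ f x‖ ≤ C ∧ ‖fderiv ℝ (fderiv ℝ f) x‖ ≤ C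

/-- The assumption on the drift: polynomial growth and a local Lipschitz condition with a
polynomially growing constant. -/
def IsPolyLocallyLipschitz {X Y : Type*} [NormedAddCommGroup X] [NormedAddCommGroup Y]
    (D : X → Y) : Prop :=
  ∃ C p q : ℝ, 0 ≤ C ∧ 0 ≤ p ∧ 0 ≤ q ∧ (∀ x, ‖D x‖ ≤ C * ‖x‖ ^ q) ∧
    ∀ x y, ‖D x - D y‖ ≤ C * max (‖x‖ ^ p) (‖y‖ ^ p) * ‖x - y‖

namespace InterpolationScale

variable {B : ℝ → Type*} [∀ a, NormedAddCommGroup (B a)] [∀ a, NormedSpace ℝ (B a)]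

/-- `-E` generates the analytic semigroup `S = (e^{-tE})_{t ≥ 0}` on the scale: on every `B_a`,
`S` is an analytic semigroup, the domain of its generator is `B_{a+1}` (with the graph norm), and
the generator is `-E`. The operators `S_t` on the different spaces are consistent. -/
structure Generates (𝓑 : InterpolationScale B) (E : ∀ a : ℝ, B (a + 1) →L[ℝ] B a)
    (S : ∀ a : ℝ, ℝ → B a →L[ℝ] B a) : Prop where
  analytic : ∀ a, IsAnalyticSemigroup (S a)
  consistent : ∀ {a b : ℝ} (h : a ≤ b) (t : ℝ) (x : B b), 0 ≤ t →
    S a t (𝓑.emb h x) = 𝓑.emb h (S b t x)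
  generator : ∀ (a : ℝ) (x : B (a + 1)),
    Tendsto (fun t : ℝ => t⁻¹ • (S a t (𝓑.emb (le_add_of_nonneg_right zero_le_one) x)
      - 𝓑.emb (le_add_of_nonneg_right zero_le_one) x)) (𝓝[>] 0) (𝓝 (-(E a x)))
  domain : ∀ (a : ℝ) (x y : B a),
    Tendsto (fun t : ℝ => t⁻¹ • (S a t x - x)) (𝓝[>] 0) (𝓝 y) →
      ∃ x' : B (a + 1), 𝓑.emb (le_add_of_nonneg_right zero_le_one) x' = x
  graph_norm : ∀ a : ℝ, ∃ C : ℝ, ∀ x : B (a + 1),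
    ‖x‖ ≤ C * (‖𝓑.emb (le_add_of_nonneg_right zero_le_one) x‖ + ‖E a x‖)

/-- `x ∈ B_a` regarded as an element of the smaller space `B_b`, `a ≤ b`, if it lies there
(otherwise an unspecified element). -/
noncomputable def lift (𝓑 : InterpolationScale B) {a b : ℝ} (h : a ≤ b) (x : B a) : B b :=
  Function.invFun (𝓑.emb h) x

theorem lift_emb (𝓑 : InterpolationScale B) {a b : ℝ} (h : a ≤ b) (x : B b) :
    𝓑.lift h (𝓑.emb h x) = x :=
  Function.leftInverse_invFun (𝓑.emb_injective h) x

/-- `y ∈ V^T = C([0,T]; B_b) ∩ C^γ([0,T]; B_a)`, where `a ≤ b`. -/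
def MemV (𝓑 : InterpolationScale B) {a b : ℝ} (h : a ≤ b) (γ T : ℝ) (y : ℝ → B b) : Prop :=
  ContinuousOn y (Icc 0 T) ∧
    ∃ K : ℝ, ∀ s ∈ Icc 0 T, ∀ t ∈ Icc 0 T, ‖𝓑.emb h (y t - y s)‖ ≤ K * |t - s| ^ γ

/-- The `k`-th dyadic Riemann sum, with values in `B_b`, of the Young integral
`∫_0^t S_{t-r} Y_r dw_r` along a path `w`, where `Y` takes values in `B_a`, `a ≤ b`:
the sum over the dyadic intervals `[n/2^k, (n+1)/2^k] ⊆ [0,t]` of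
`(w_{(n+1)/2^k} - w_{n/2^k}) S_{t-n/2^k} Y_{n/2^k}`. -/
noncomputable def youngSum (𝓑 : InterpolationScale B) (S : ∀ a : ℝ, ℝ → B a →L[ℝ] B a)
    {a b : ℝ} (h : a ≤ b) (w : ℝ≥0 → ℝ) (Y : ℝ → B a) (t : ℝ) (k : ℕ) : B b :=
  ∑ n ∈ Finset.range ⌊t * 2 ^ k⌋₊,
    (w ((n + 1) / 2 ^ k) - w (n / 2 ^ k)) •
      𝓑.lift h (S a (t - n / 2 ^ k) (Y (n / 2 ^ k)))

/-- `y ∈ V^T` is a mild solution on `[0,T]` of `dy + (D + E) y dt + F y dw = 0`, `y_0 = x₀`: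
for all `t ∈ [0,T]`,
`y_t = S_t x₀ - ∫_0^t S_{t-s} D(y_s) ds - ∫_0^t S_{t-s} F(y_s) dw_s` in `B_α`,
where the first integral is a (convergent) Bochner integral in `B_α`, and the second one is a Young
integral, the limit in `B_α` of the dyadic Riemann sums. -/
def IsMildSolution (𝓑 : InterpolationScale B) (S : ∀ a : ℝ, ℝ → B a →L[ℝ] B a)
    {α β γ θ : ℝ} (hβ : α - β ≤ α) (hγ : α - γ ≤ α) (hθ : α - θ ≤ α)
    (D : B α → B (α - β)) (F : B α → B (α - θ)) (w : ℝ≥0 → ℝ) (x₀ : B α) (T : ℝ)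
    (y : ℝ → B α) : Prop :=
  𝓑.MemV hγ γ T y ∧
  ∀ t ∈ Icc 0 T,
    IntervalIntegrable (fun s => 𝓑.lift hβ (S (α - β) (t - s) (D (y s)))) volume 0 t ∧
    ∃ I : B α, Tendsto (𝓑.youngSum S hθ w (fun s => F (y s)) t) atTop (𝓝 I) ∧
      y t = S α t x₀ - (∫ s in (0 : ℝ)..t, 𝓑.lift hβ (S (α - β) (t - s) (D (y s)))) - I

end InterpolationScale

/-- A fractional Brownian motion `(W_t)_{t ≥ 0}` with Hurst parameter `H`: a centred Gaussian
process with almost surely continuous paths and covariance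
`(s^{2H} + t^{2H} - |t - s|^{2H}) / 2`. -/
structure IsFractionalBrownianMotion {Ω : Type*} [MeasurableSpace Ω] (H : ℝ) (W : ℝ≥0 → Ω → ℝ)
    (P : Measure Ω) : Prop where
  gaussian : IsGaussianProcess W P
  centered : ∀ t, ∫ o, W t o ∂P = 0
  covariance : ∀ s t : ℝ≥0, covariance (W s) (W t) P =
    ((s : ℝ) ^ (2 * H) + (t : ℝ) ^ (2 * H) - |(t : ℝ) - s| ^ (2 * H)) / 2
  continuous : ∀ᵐ o ∂P, Continuous fun t => W t o

/-!
The equation is solved pathwise, by a fixed point argument in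
`V^T = C([0,T]; B_α) ∩ C^γ([0,T]; B_{α-γ})`.

The probabilistic input is `IsFractionalBrownianMotion.ae_exists_dyadicHolder`: by the Gaussian tail
bound and the Borel-Cantelli lemma, for every `η < H` almost every path satisfies
`|W_{(n+1)/2^k} - W_{n/2^k}| ≤ K 2^{-kη}` for all dyadic intervals in `[0,1]`. The Riemann sums in
the definition of the Young integral are dyadic, so no other increments of the path ever occur; the
exponent `η` is fixed in `(γ, H)`.

From the semigroup only two estimates are used, both valid for `0 < t ≤ 1`:
`‖S_t x‖_b ≤ C t^{-(b-a)} ‖x‖_a` (`Generates.exists_norm_smoothing_le`) and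
`‖S_t x - x‖_a ≤ C t^{b-a} ‖x‖_b` for `b - a ≤ 1` (`Generates.exists_norm_sub_le`). They follow
from Cauchy's inequality for the holomorphic extension, from the description of the domain of the
generator, and from interpolation.

For an integrand `Y` that is bounded in `B_{α-θ}` and `γ`-Hölder in `B_{α-γ-θ}`, the function
`u ↦ S_{t-u} Y_u` is bounded by `(t-u)^{-τ}`, and its increments over `[u,v]` are bounded by
`(t-v)^{-(γ+τ)} (v-u)^γ`, in a target space that depends on `τ`. Comparing the Riemann sums of
consecutive dyadic levels shows that they converge if `τ < η` and `γ + η > 1`, and that the limit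
over `[s,t]` has order `(t-s)^{η-τ}` (`exists_tendsto_dyadicSum`). The choice `τ = 0` gives the bound
in `B_{α-γ}`, and `τ = θ + ε` a bound in `B_{α+ε}`, which is needed for continuity in `B_α`: if
`I_t` is the convolution, then `I_t - I_s = (S_{t-s} - 1) I_s + ∫_s^t`, and `I_s` has to be slightly
more regular than `B_α`. The drift is treated in the same way, with elementary integrals. The
result is `Generates.exists_mildConvolution_estimate`: if the integrands vanish before a time `τ`,
then the norm of the convolution in `V^T` gains a factor `(T-τ)^κ`.

Since `F'` has two bounded derivatives, `y ↦ F(y)` is Lipschitz on bounded sets of paths, including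
the Hölder seminorm (`exists_vBound_comp`). With `τ = 0` the estimate gives a contraction on a ball
for small `T`, hence existence. With `τ > 0` it shows that two solutions that agree up to time `τ`
agree on a further interval whose length depends only on their norms, hence uniqueness in all
of `V^T`.
-/


/-! ### Analytic semigroups on a single space -/

section Semigroup

variable {X : Type*} [NormedAddCommGroup X] [NormedSpace ℝ X] {S : ℝ → X →L[ℝ] X}

theorem IsAnalyticSemigroup.exists_norm_le (hS : IsAnalyticSemigroup S) :
    ∃ M : ℝ, 1 ≤ M ∧ ∀ t ∈ Icc (0 : ℝ) 1, ‖S t‖ ≤ M := by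
  obtain ⟨δ, hδ, -, P, Q, hPQ, -, M, hM⟩ := hS.exists_extension
  refine ⟨max M 1, le_max_right _ _, fun t ht => ?_⟩
  rcases ht.1.eq_or_lt with rfl | h0
  · rw [hS.zero]
    exact ContinuousLinearMap.norm_id_le.trans (le_max_right _ _)
  · rw [← (hPQ t h0).1]
    refine (hM t (by exact_mod_cast h0.ne') ?_ ?_).1.trans (le_max_left _ _)
    · rwa [Complex.arg_ofReal_of_nonneg h0.le, abs_zero]
    · rw [Complex.norm_real, Real.norm_of_nonneg h0.le]
      exact ht.2

/-- Right-continuity at `0` and local boundedness give continuity from the left as well, because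
`S_t x - S_s x = S_s (S_{t-s} x - x)`. -/
theorem IsC0Semigroup.continuousOn (hS : IsC0Semigroup S) {M : ℝ}
    (hM : ∀ t ∈ Icc (0 : ℝ) 1, ‖S t‖ ≤ M) (x : X) :
    ContinuousOn (fun t => S t x) (Icc 0 1) := by
  have hM0 : 0 ≤ M := (norm_nonneg _).trans (hM 0 (by simp))
  have key : ∀ s ∈ Icc (0 : ℝ) 1, ∀ t ∈ Icc (0 : ℝ) 1, s ≤ t →
      ‖S t x - S s x‖ ≤ M * ‖S (|t - s|) x - x‖ := by
    intro s hs t ht hst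
    have h : S t = (S s).comp (S (t - s)) := by
      rw [← hS.add s (t - s) hs.1 (by linarith)]
      congr 1
      ring
    rw [h, abs_of_nonneg (by linarith), ContinuousLinearMap.comp_apply, ← map_sub]
    exact ((S s).le_opNorm _).trans (mul_le_mul_of_nonneg_right (hM s hs) (norm_nonneg _))
  have h0 : Tendsto (fun h : ℝ => S h x) (𝓝[≥] 0) (𝓝 x) := by
    have h1 : 𝓝[≥] (0 : ℝ) = 𝓝[{0} ∪ Ioi 0] 0 := by
      congr 1
      ext y
      simp [le_iff_eq_or_lt, eq_comm]
    rw [h1, nhdsWithin_union, nhdsWithin_singleton]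
    refine Tendsto.sup ?_ (hS.strongly_continuous x)
    rw [tendsto_pure_left]
    intro s hs
    rw [hS.zero]
    exact mem_of_mem_nhds hs
  intro s hs
  rw [ContinuousWithinAt, tendsto_iff_norm_sub_tendsto_zero]
  have habs : Tendsto (fun t : ℝ => |t - s|) (𝓝[Icc 0 1] s) (𝓝[≥] 0) := by
    refine tendsto_nhdsWithin_iff.2 ⟨?_, Eventually.of_forall fun t => mem_Ici.2 (abs_nonneg _)⟩
    refine (Continuous.tendsto' (by fun_prop) s 0 (by simp)).mono_left nhdsWithin_le_nhds
  have h2 : Tendsto (fun t : ℝ => M * ‖S (|t - s|) x - x‖) (𝓝[Icc 0 1] s) (𝓝 0) := by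
    have := ((h0.comp habs).sub_const x).norm.const_mul M
    simpa using this
  refine squeeze_zero' (Eventually.of_forall fun t => norm_nonneg _) ?_ h2
  filter_upwards [self_mem_nhdsWithin] with t ht
  rcases le_total s t with h | h
  · exact key s hs t ht h
  · rw [norm_sub_rev, abs_sub_comm]
    exact key t ht s hs h

/-- The Cauchy estimate `‖S'_t‖ ≤ C / t` for an analytic semigroup. The real and imaginary part
of the holomorphic extension are tested against real functionals, so that Cauchy's inequality
is only used for scalar functions. -/
theorem IsAnalyticSemigroup.exists_hasDerivAt (hS : IsAnalyticSemigroup S) :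
    ∃ C : ℝ, 0 ≤ C ∧ ∀ t : ℝ, 0 < t → t ≤ 1 / 2 →
      ∃ A : X →L[ℝ] X, HasDerivAt S A t ∧ ‖A‖ ≤ C / t := by
  obtain ⟨δ, hδ, -, P, Q, hPQ, hCR, M, hM⟩ := hS.exists_extension
  -- a disc around `1` inside the sector, scaled by `t`
  obtain ⟨c, hc0, hc1, hc⟩ : ∃ c : ℝ, 0 < c ∧ c < 1 ∧
      ∀ z : ℂ, ‖z - 1‖ ≤ c → z ≠ 0 ∧ |z.arg| < δ := by
    have h1 : ∀ᶠ z : ℂ in 𝓝 1, |z.arg| < δ := by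
      have : ContinuousAt (fun z : ℂ => |z.arg|) 1 :=
        (Complex.continuousAt_arg (by simp)).abs
      exact this.eventually_lt continuousAt_const (by simpa using hδ)
    obtain ⟨r, hr, hr'⟩ := Metric.eventually_nhds_iff.1 h1
    refine ⟨min (r / 2) (1 / 2), by positivity, by
      exact (min_le_right _ _).trans_lt (by norm_num), fun z hz => ⟨?_, ?_⟩⟩
    · rintro rfl
      have := hz.trans (min_le_right _ _)
      norm_num at this
    · apply hr'
      rw [dist_eq_norm]
      exact (hz.trans (min_le_left _ _)).trans_lt (by linarith)
  have hM0 : 0 ≤ M := (norm_nonneg _).trans (hM (1 : ℝ) (by simp) (by simpa using hδ) (by simp)).1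
  refine ⟨2 * M / c, by positivity, fun t ht0 ht => ?_⟩
  have hball : ∀ z : ℂ, ‖z - t‖ ≤ c * t → z ≠ 0 ∧ |z.arg| < δ ∧ ‖z‖ ≤ 1 := by
    intro z hz
    have htC : (t : ℂ) ≠ 0 := by exact_mod_cast ht0.ne'
    have hz' : z = (t : ℂ) * (z / t) := by field_simp
    have h1 : ‖z / t - 1‖ ≤ c := by
      have : z / t - 1 = (z - t) / t := by field_simp
      rw [this, norm_div, Complex.norm_real, Real.norm_of_nonneg ht0.le, div_le_iff₀ ht0]
      exact hz
    obtain ⟨h2, h3⟩ := hc _ h1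
    refine ⟨?_, ?_, ?_⟩
    · rw [hz']
      exact mul_ne_zero htC h2
    · rw [hz', Complex.arg_real_mul _ ht0]
      exact h3
    · calc ‖z‖ = ‖(z - t) + t‖ := by ring_nf
        _ ≤ ‖z - t‖ + ‖(t : ℂ)‖ := norm_add_le _ _
        _ ≤ c * t + t := by
          rw [Complex.norm_real, Real.norm_of_nonneg ht0.le]
          linarith
        _ ≤ 1 := by nlinarith
  obtain ⟨htne, htarg, -⟩ := hball t (by simp; positivity)
  obtain ⟨P', Q', hP', -⟩ := hCR t htne htarg
  refine ⟨P', ?_, ?_⟩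
  · have h1 : HasDerivAt (fun s : ℝ => P (s : ℂ)) P' t := by
      have h2 : HasDerivAt (fun s : ℝ => (s : ℂ)) 1 t := Complex.ofRealCLM.hasDerivAt
      have := hP'.comp_hasDerivAt t h2
      have hv : (Complex.reCLM.smulRight P' - Complex.imCLM.smulRight Q') (1 : ℂ) = P' := by simp
      rwa [hv] at this
    refine h1.congr_of_eventuallyEq ?_
    filter_upwards [lt_mem_nhds ht0] with s hs
    exact (hPQ s hs).1.symm
  · refine ContinuousLinearMap.opNorm_le_bound _ (by positivity) fun x => ?_
    refine NormedSpace.norm_le_dual_bound ℝ _ (by positivity) fun f => ?_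
    -- `z ↦ f (P_z x) + i f (Q_z x)` is a scalar holomorphic function
    set g : ℂ → ℂ := fun z => (f (P z x) : ℂ) + (f (Q z x) : ℂ) * Complex.I with hg
    have hderiv : ∀ z : ℂ, z ≠ 0 → |z.arg| < δ → ∀ P₁ Q₁ : X →L[ℝ] X,
        HasFDerivAt P (Complex.reCLM.smulRight P₁ - Complex.imCLM.smulRight Q₁) z →
        HasFDerivAt Q (Complex.reCLM.smulRight Q₁ + Complex.imCLM.smulRight P₁) z →
        HasDerivAt g ((f (P₁ x) : ℂ) + (f (Q₁ x) : ℂ) * Complex.I) z := by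
      intro z _ _ P₁ Q₁ h1 h2
      have h1' := ((f.comp (ContinuousLinearMap.apply ℝ X x)).hasFDerivAt.comp z h1)
      have h2' := ((f.comp (ContinuousLinearMap.apply ℝ X x)).hasFDerivAt.comp z h2)
      have h1c := Complex.ofRealCLM.hasFDerivAt.comp z h1'
      have h2c := (Complex.ofRealCLM.hasFDerivAt.comp z h2').mul_const Complex.I
      have h3 := h1c.add h2c
      rw [hasDerivAt_iff_hasFDerivAt]
      refine hasFDerivAt_of_restrictScalars ℝ h3 ?_
      ext w
      apply Complex.ext <;> simp
    have hbound : ∀ z ∈ Metric.sphere (t : ℂ) (c * t), ‖g z‖ ≤ 2 * M * ‖f‖ * ‖x‖ := by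
      intro z hz
      rw [Metric.mem_sphere, dist_eq_norm] at hz
      obtain ⟨h1, h2, h3⟩ := hball z hz.le
      obtain ⟨h4, h5⟩ := hM z h1 h2 h3
      have hb : ∀ A : X →L[ℝ] X, ‖A‖ ≤ M → |f (A x)| ≤ M * ‖f‖ * ‖x‖ := by
        intro A hA
        calc |f (A x)| ≤ ‖f‖ * ‖A x‖ := f.le_opNorm _
          _ ≤ ‖f‖ * (M * ‖x‖) := by
            gcongr
            exact (A.le_opNorm x).trans (by gcongr)
          _ = M * ‖f‖ * ‖x‖ := by ring
      calc ‖g z‖ ≤ |f (P z x)| + |f (Q z x)| := by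
            refine (norm_add_le _ _).trans ?_
            simp
        _ ≤ 2 * M * ‖f‖ * ‖x‖ := by linarith [hb _ h4, hb _ h5]
    have hdiff : DiffContOnCl ℂ g (Metric.ball (t : ℂ) (c * t)) := by
      refine DifferentiableOn.diffContOnCl fun z hz => ?_
      have hz' := Metric.closure_ball_subset_closedBall hz
      rw [Metric.mem_closedBall, dist_eq_norm] at hz'
      obtain ⟨h1, h2, -⟩ := hball z hz'
      obtain ⟨P₁, Q₁, h3, h4⟩ := hCR z h1 h2
      exact (hderiv z h1 h2 P₁ Q₁ h3 h4).differentiableAt.differentiableWithinAt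
    obtain ⟨P₁, Q₁, h3, h4⟩ := hCR t htne htarg
    have hP₁ : P₁ = P' := by
      have := congrArg (fun L : ℂ →L[ℝ] (X →L[ℝ] X) => L 1) (h3.unique hP')
      simpa using this
    subst hP₁
    have hd := hderiv t htne htarg P₁ Q₁ h3 h4
    have hle := Complex.norm_deriv_le_of_forall_mem_sphere_norm_le (by positivity) hdiff hbound
    rw [hd.deriv] at hle
    calc ‖f (P₁ x)‖ ≤ ‖(f (P₁ x) : ℂ) + (f (Q₁ x) : ℂ) * Complex.I‖ := by
          have := Complex.abs_re_le_norm ((f (P₁ x) : ℂ) + (f (Q₁ x) : ℂ) * Complex.I)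
          simpa using this
      _ ≤ 2 * M * ‖f‖ * ‖x‖ / (c * t) := hle
      _ = 2 * M / c / t * ‖x‖ * ‖f‖ := by
        field_simp

end Semigroup

/-! ### Smoothing on the scale -/

namespace InterpolationScale

variable {B : ℝ → Type*} [∀ a, NormedAddCommGroup (B a)] [∀ a, NormedSpace ℝ (B a)]
  {𝓑 : InterpolationScale B} {E : ∀ a : ℝ, B (a + 1) →L[ℝ] B a} {S : ∀ a : ℝ, ℝ → B a →L[ℝ] B a}

theorem exists_norm_emb_le (𝓑 : InterpolationScale B) {a b : ℝ} (h : a ≤ b) :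
    ∃ C : ℝ, 0 ≤ C ∧ ∀ x : B b, ‖𝓑.emb h x‖ ≤ C * ‖x‖ :=
  ⟨‖𝓑.emb h‖, norm_nonneg _, (𝓑.emb h).le_opNorm⟩

namespace Generates

/-- For `t > 0` the orbit `s ↦ S_s x` is differentiable at `t`, so `S_t x` lies in the domain
`B_{a+1}` of the generator, and the graph norm turns the bound of the derivative into a bound in
`B_{a+1}`. -/
theorem exists_lift_succ_of_le_half (hE : 𝓑.Generates E S) (a : ℝ) :
    ∃ C : ℝ, 0 ≤ C ∧ ∀ t : ℝ, 0 < t → t ≤ 1 / 2 → ∀ x : B a, ∃ x' : B (a + 1),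
      𝓑.emb (le_add_of_nonneg_right zero_le_one) x' = S a t x ∧ ‖x'‖ ≤ C / t * ‖x‖ := by
  obtain ⟨C₁, hC₁, hA⟩ := (hE.analytic a).exists_hasDerivAt
  obtain ⟨M, hM1, hM⟩ := (hE.analytic a).exists_norm_le
  obtain ⟨C₂, hC₂⟩ := hE.graph_norm a
  refine ⟨|C₂| * (M + C₁), by positivity, fun t ht0 ht x => ?_⟩
  obtain ⟨A, hA, hAle⟩ := hA t ht0 ht
  have hlim : Tendsto (fun h : ℝ => h⁻¹ • (S a h (S a t x) - S a t x)) (𝓝[>] 0) (𝓝 (A x)) := by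
    have h1 : HasDerivAt (fun s => S a s x) (A x) t := by
      have := hA.clm_apply (hasDerivAt_const t x)
      simpa using this
    refine (h1.tendsto_slope_zero_right).congr' ?_
    filter_upwards [self_mem_nhdsWithin] with h hh
    rw [add_comm t h, (hE.analytic a).add h t (le_of_lt hh) ht0.le]
    rfl
  obtain ⟨x', hx'⟩ := hE.domain a _ _ hlim
  refine ⟨x', hx', ?_⟩
  have hEx : -(E a x') = A x := by
    have := hE.generator a x'
    rw [hx'] at this
    exact tendsto_nhds_unique this hlim
  have hEx' : ‖E a x'‖ = ‖A x‖ := by rw [← hEx, norm_neg]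
  have h1 : ‖S a t x‖ ≤ M * ‖x‖ :=
    ((S a t).le_opNorm x).trans (by gcongr; exact hM t ⟨ht0.le, by linarith⟩)
  have h2 : ‖A x‖ ≤ C₁ / t * ‖x‖ := (A.le_opNorm x).trans (by gcongr)
  have h3 : M ≤ M / t := by
    rw [le_div_iff₀ ht0]
    nlinarith
  calc ‖x'‖ ≤ C₂ * (‖S a t x‖ + ‖E a x'‖) := by
        have := hC₂ x'
        rwa [hx'] at this
    _ ≤ |C₂| * (M / t * ‖x‖ + C₁ / t * ‖x‖) := by
      rw [hEx']
      gcongr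
      · exact le_abs_self _
      · exact h1.trans (by gcongr)
    _ = |C₂| * (M + C₁) / t * ‖x‖ := by ring

theorem exists_lift_succ (hE : 𝓑.Generates E S) {a b : ℝ} (hb : b = a + 1) (h : a ≤ b) :
    ∃ C : ℝ, 0 ≤ C ∧ ∀ t : ℝ, 0 < t → t ≤ 1 → ∀ x : B a, ∃ x' : B b,
      𝓑.emb h x' = S a t x ∧ ‖x'‖ ≤ C / t * ‖x‖ := by
  subst hb
  obtain ⟨C, hC, hx⟩ := hE.exists_lift_succ_of_le_half a
  obtain ⟨M, hM1, hM⟩ := (hE.analytic (a + 1)).exists_norm_le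
  refine ⟨M * (2 * C), by positivity, fun t ht0 ht x => ?_⟩
  obtain ⟨x', hx', hle⟩ := hx (t / 2) (by positivity) (by linarith) x
  refine ⟨S (a + 1) (t / 2) x', ?_, ?_⟩
  · rw [← hE.consistent h (t / 2) x' (by positivity), hx', ← ContinuousLinearMap.comp_apply,
      ← (hE.analytic a).add _ _ (by positivity) (by positivity), add_halves]
  · calc ‖S (a + 1) (t / 2) x'‖ ≤ M * (C / (t / 2) * ‖x‖) :=
        ((S (a + 1) (t / 2)).le_opNorm x').trans
          (mul_le_mul (hM _ ⟨by positivity, by linarith⟩) hle (norm_nonneg _) (by linarith))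
      _ = M * (2 * C) / t * ‖x‖ := by field_simp

/-- Smoothing by up to `n` indices, from `n` applications of `exists_lift_succ`: at each step, half
of the time is spent on the last index. -/
theorem exists_lift_nat (hE : 𝓑.Generates E S) {a : ℝ} (n : ℕ) :
    ∀ {b : ℝ} (h : a ≤ b), b ≤ a + n → ∃ C : ℝ, 0 ≤ C ∧ ∀ t : ℝ, 0 < t → t ≤ 1 → ∀ x : B a,
      ∃ x' : B b, 𝓑.emb h x' = S a t x ∧ ‖x'‖ ≤ C / t ^ n * ‖x‖ := by
  induction n with
  | zero =>
    intro b h hb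
    obtain rfl : a = b := le_antisymm h (by simpa using hb)
    obtain ⟨M, hM1, hM⟩ := (hE.analytic a).exists_norm_le
    refine ⟨M, by linarith, fun t ht0 ht x => ⟨S a t x, 𝓑.emb_refl _ _, ?_⟩⟩
    simpa using ((S a t).le_opNorm x).trans (by gcongr; exact hM t ⟨ht0.le, ht⟩)
  | succ n ih =>
    intro b h hb
    push_cast at hb
    rcases le_total b (a + 1) with hb1 | hb1
    · obtain ⟨C, hC, hx⟩ := hE.exists_lift_succ (a := a) rfl (by linarith)
      obtain ⟨C', hC', hemb⟩ := 𝓑.exists_norm_emb_le hb1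
      refine ⟨C' * C, by positivity, fun t ht0 ht x => ?_⟩
      obtain ⟨x', hx', hle⟩ := hx t ht0 ht x
      refine ⟨𝓑.emb hb1 x', by rw [𝓑.emb_comp, hx'], (hemb x').trans ?_⟩
      calc C' * ‖x'‖ ≤ C' * (C / t * ‖x‖) := by gcongr
        _ ≤ C' * (C / t ^ (n + 1) * ‖x‖) := by
          gcongr
          exact pow_le_of_le_one ht0.le ht (by simp)
        _ = C' * C / t ^ (n + 1) * ‖x‖ := by ring
    · obtain ⟨C, hC, hx⟩ := ih (b := b - 1) (by linarith) (by linarith)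
      obtain ⟨C', hC', hx'⟩ := hE.exists_lift_succ (a := b - 1) (b := b) (by ring) (by linarith)
      refine ⟨C' * 2 * C * 2 ^ n, by positivity, fun t ht0 ht x => ?_⟩
      obtain ⟨x₁, hx₁, hle₁⟩ := hx (t / 2) (by positivity) (by linarith) x
      obtain ⟨x₂, hx₂, hle₂⟩ := hx' (t / 2) (by positivity) (by linarith) x₁
      refine ⟨x₂, ?_, hle₂.trans ?_⟩
      · rw [← 𝓑.emb_comp (show a ≤ b - 1 by linarith) (by linarith), hx₂,
          ← hE.consistent _ _ _ (by positivity), hx₁, ← ContinuousLinearMap.comp_apply,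
          ← (hE.analytic a).add _ _ (by positivity) (by positivity), add_halves]
      · calc C' / (t / 2) * ‖x₁‖ ≤ C' / (t / 2) * (C / (t / 2) ^ n * ‖x‖) := by gcongr
          _ = C' * 2 * C * 2 ^ n / t ^ (n + 1) * ‖x‖ := by
            rw [div_pow]
            field_simp
            ring

/-- The parabolic smoothing estimate `‖S_t x‖_b ≤ C t^{-(b-a)} ‖x‖_a`: interpolation between the
estimates for integer differences of the indices. -/
theorem exists_lift (hE : 𝓑.Generates E S) {a b : ℝ} (h : a ≤ b) :
    ∃ C : ℝ, 0 ≤ C ∧ ∀ t : ℝ, 0 < t → t ≤ 1 → ∀ x : B a,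
      ∃ x' : B b, 𝓑.emb h x' = S a t x ∧ ‖x'‖ ≤ C * t ^ (-(b - a)) * ‖x‖ := by
  obtain ⟨n, hn⟩ := exists_nat_ge (b - a + 1)
  have hn0 : (0 : ℝ) < n := by linarith
  have hbc : b ≤ a + n := by linarith
  obtain ⟨C₁, hC₁, hx⟩ := hE.exists_lift_nat n (h.trans hbc) le_rfl
  obtain ⟨M, hM1, hM⟩ := (hE.analytic a).exists_norm_le
  obtain ⟨C₂, hC₂⟩ := 𝓑.interpolation h hbc
  set σ := b - a with hσ
  have hσ0 : 0 ≤ σ := by linarith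
  refine ⟨(|C₂| * (M ^ (n - σ) * C₁ ^ σ)) ^ (1 / (n : ℝ)), by positivity, fun t ht0 ht x => ?_⟩
  obtain ⟨x', hx', hle⟩ := hx t ht0 ht x
  refine ⟨𝓑.emb hbc x', by rw [𝓑.emb_comp, hx'], ?_⟩
  have h1 : ‖S a t x‖ ≤ M * ‖x‖ :=
    ((S a t).le_opNorm x).trans (by gcongr; exact hM t ⟨ht0.le, by linarith⟩)
  have h2 : ‖𝓑.emb hbc x'‖ ^ (n : ℝ) ≤
      (|C₂| * (M ^ (n - σ) * C₁ ^ σ)) * (t ^ (-σ) * ‖x‖) ^ (n : ℝ) := by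
    have h3 := hC₂ x'
    rw [hx', show a + n - a = (n : ℝ) by ring, show a + n - b = n - σ by rw [hσ]; ring] at h3
    calc ‖𝓑.emb hbc x'‖ ^ (n : ℝ) ≤ C₂ * (‖S a t x‖ ^ (n - σ) * ‖x'‖ ^ σ) := h3
      _ ≤ |C₂| * ((M * ‖x‖) ^ (n - σ) * (C₁ / t ^ n * ‖x‖) ^ σ) := by
        gcongr
        · exact le_abs_self _
        · linarith
      _ = (|C₂| * (M ^ (n - σ) * C₁ ^ σ)) * (t ^ (-σ) * ‖x‖) ^ (n : ℝ) := by
        have e1 : C₁ / t ^ n * ‖x‖ = C₁ * (t ^ (-(n : ℝ)) * ‖x‖) := by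
          rw [Real.rpow_neg ht0.le, Real.rpow_natCast]
          ring
        have e2 : ‖x‖ ^ (n : ℝ) = ‖x‖ ^ (n - σ) * ‖x‖ ^ σ := by
          rw [← Real.rpow_add' (norm_nonneg _) (by linarith), sub_add_cancel]
        have e3 : (t ^ (-(n : ℝ))) ^ σ = (t ^ (-σ)) ^ (n : ℝ) := by
          rw [← Real.rpow_mul ht0.le, ← Real.rpow_mul ht0.le]
          congr 1
          ring
        rw [e1, Real.mul_rpow (by linarith) (norm_nonneg _), Real.mul_rpow hC₁ (by positivity),
          Real.mul_rpow (by positivity) (norm_nonneg _),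
          Real.mul_rpow (by positivity) (norm_nonneg _), e2, e3]
        ring
  have h4 := Real.rpow_le_rpow (by positivity) h2 (show 0 ≤ 1 / (n : ℝ) by positivity)
  rw [← Real.rpow_mul (norm_nonneg _), Real.mul_rpow (by positivity) (by positivity),
    ← Real.rpow_mul (by positivity), mul_one_div_cancel hn0.ne', Real.rpow_one, Real.rpow_one] at h4
  linarith

/-- The orbit of a point of the domain is Lipschitz. Its right derivative `S_s (-E x)` suffices for
the mean value inequality. -/
theorem exists_norm_sub_le_succ (hE : 𝓑.Generates E S) {a b : ℝ} (hb : b = a + 1) (h : a ≤ b) :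
    ∃ C : ℝ, 0 ≤ C ∧ ∀ t : ℝ, 0 ≤ t → t ≤ 1 → ∀ x : B b,
      ‖S a t (𝓑.emb h x) - 𝓑.emb h x‖ ≤ C * t * ‖x‖ := by
  subst hb
  obtain ⟨M, hM1, hM⟩ := (hE.analytic a).exists_norm_le
  refine ⟨M * ‖E a‖, by positivity, fun t ht0 ht x => ?_⟩
  have hderiv : ∀ s ∈ Ico (0 : ℝ) 1,
      HasDerivWithinAt (fun r => S a r (𝓑.emb h x)) (S a s (-(E a x))) (Ici s) s := by
    intro s hs
    rw [← hasDerivWithinAt_Ioi_iff_Ici, hasDerivWithinAt_iff_tendsto_slope' (by simp)]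
    have h1 := ((S a s).continuous.tendsto _).comp (hE.generator a x)
    have h2 : Tendsto (fun r : ℝ => r - s) (𝓝[>] s) (𝓝[>] 0) := by
      refine tendsto_nhdsWithin_iff.2 ⟨?_, ?_⟩
      · exact (Continuous.tendsto' (by fun_prop) s 0 (by simp)).mono_left nhdsWithin_le_nhds
      · filter_upwards [self_mem_nhdsWithin] with r hr
        exact sub_pos.2 (mem_Ioi.1 hr)
    refine (h1.comp h2).congr' ?_
    filter_upwards [self_mem_nhdsWithin] with r hr
    have hr' : s < r := hr
    have h3 : S a r = (S a s).comp (S a (r - s)) := by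
      rw [← (hE.analytic a).add s (r - s) hs.1 (by linarith)]
      congr 1
      ring
    simp [slope, h3]
  have hcont := (hE.analytic a).toIsC0Semigroup.continuousOn hM (𝓑.emb h x)
  have := norm_image_sub_le_of_norm_deriv_right_le_segment (C := M * ‖E a‖ * ‖x‖) hcont hderiv
    (fun s hs => by
      calc ‖S a s (-(E a x))‖ ≤ ‖S a s‖ * ‖-(E a x)‖ := (S a s).le_opNorm _
        _ ≤ M * (‖E a‖ * ‖x‖) := by
          rw [norm_neg]
          gcongr
          · exact hM s ⟨hs.1, hs.2.le⟩
          · exact (E a).le_opNorm x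
        _ = M * ‖E a‖ * ‖x‖ := by ring) t ⟨ht0, ht⟩
  rw [(hE.analytic a).zero] at this
  simp only [ContinuousLinearMap.id_apply, sub_zero] at this
  linarith

/-- The time regularity estimate `‖S_t x - x‖_a ≤ C t^{b-a} ‖x‖_b`, `a ≤ b ≤ a + 1`: interpolation
of the index `a` between `b - 1` and `b`. -/
theorem exists_norm_sub_le (hE : 𝓑.Generates E S) {a b : ℝ} (h : a ≤ b) (hb : b ≤ a + 1) :
    ∃ C : ℝ, 0 ≤ C ∧ ∀ t : ℝ, 0 ≤ t → t ≤ 1 → ∀ x : B b,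
      ‖S a t (𝓑.emb h x) - 𝓑.emb h x‖ ≤ C * t ^ (b - a) * ‖x‖ := by
  obtain ⟨C₁, hC₁, hx⟩ := hE.exists_norm_sub_le_succ (a := b - 1) (b := b) (by ring) (by linarith)
  obtain ⟨M, hM1, hM⟩ := (hE.analytic b).exists_norm_le
  have h1 : b - 1 ≤ a := by linarith
  obtain ⟨C₂, hC₂⟩ := 𝓑.interpolation h1 h
  refine ⟨|C₂| * (C₁ ^ (b - a) * (M + 1) ^ (a - (b - 1))), by positivity, fun t ht0 ht x => ?_⟩
  have e1 : S a t (𝓑.emb h x) - 𝓑.emb h x = 𝓑.emb h (S b t x - x) := by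
    rw [map_sub, hE.consistent h t x ht0]
  have e2 : 𝓑.emb (h1.trans h) (S b t x - x) =
      S (b - 1) t (𝓑.emb (h1.trans h) x) - 𝓑.emb (h1.trans h) x := by
    rw [map_sub, hE.consistent (h1.trans h) t x ht0]
  have h2 : ‖S b t x - x‖ ≤ (M + 1) * ‖x‖ := by
    refine (norm_sub_le _ _).trans ?_
    have := ((S b t).le_opNorm x).trans
      (mul_le_mul_of_nonneg_right (hM t ⟨ht0, ht⟩) (norm_nonneg x))
    linarith
  have h3 := hC₂ (S b t x - x)
  rw [e2, show b - (b - 1) = 1 by ring, Real.rpow_one, ← e1] at h3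
  calc _ ≤ _ := h3
    _ ≤ |C₂| * ((C₁ * t * ‖x‖) ^ (b - a) * ((M + 1) * ‖x‖) ^ (a - (b - 1))) := by
      gcongr
      · exact le_abs_self _
      · exact hx t ht0 ht x
    _ = |C₂| * (C₁ ^ (b - a) * (M + 1) ^ (a - (b - 1))) * t ^ (b - a) * ‖x‖ := by
      have e3 : ‖x‖ = ‖x‖ ^ (b - a) * ‖x‖ ^ (a - (b - 1)) := by
        rw [← Real.rpow_add' (norm_nonneg _) (by norm_num),
          show b - a + (a - (b - 1)) = 1 by ring, Real.rpow_one]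
      rw [Real.mul_rpow (by positivity) (norm_nonneg _), Real.mul_rpow hC₁ ht0,
        Real.mul_rpow (by positivity) (norm_nonneg _)]
      conv_rhs => rw [e3]
      ring

/-- The semigroup as an operator from `B_a` to `B_b` at positive times, for arbitrary indices. -/
theorem exists_smoothing (hE : 𝓑.Generates E S) (a b : ℝ) :
    ∃ U : ℝ → B a →L[ℝ] B b,
      (∀ t, 0 < t → t ≤ 1 → ∀ c (hca : c ≤ a) (hcb : c ≤ b) (x : B a),
        𝓑.emb hcb (U t x) = S c t (𝓑.emb hca x)) ∧
      ∃ C : ℝ, 0 ≤ C ∧ ∀ t, 0 < t → t ≤ 1 → ‖U t‖ ≤ C * t ^ (-max (b - a) 0) := by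
  obtain ⟨C, hC, hx⟩ := hE.exists_lift (min_le_right a b)
  have key : ∀ t : ℝ, ∃ L : B a →L[ℝ] B b, 0 < t → t ≤ 1 →
      (∀ x, 𝓑.emb (min_le_right a b) (L x) = S (min a b) t (𝓑.emb (min_le_left a b) x)) ∧
      ‖L‖ ≤ C * t ^ (-(b - min a b)) * ‖𝓑.emb (min_le_left a b)‖ := by
    intro t
    by_cases ht : 0 < t ∧ t ≤ 1
    swap
    · exact ⟨0, fun h1 h2 => (ht ⟨h1, h2⟩).elim⟩
    choose L hL hLle using fun x => hx t ht.1 ht.2 (𝓑.emb (min_le_left a b) x)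
    refine ⟨LinearMap.mkContinuous ⟨⟨L, ?_⟩, ?_⟩
      (C * t ^ (-(b - min a b)) * ‖𝓑.emb (min_le_left a b)‖) ?_, fun _ _ => ⟨hL, ?_⟩⟩
    · intro x y
      apply 𝓑.emb_injective (min_le_right a b)
      rw [map_add, hL, hL, hL, map_add, map_add]
    · intro r x
      apply 𝓑.emb_injective (min_le_right a b)
      simp only [map_smul, hL, RingHom.id_apply]
    · intro x
      refine (hLle x).trans ?_
      rw [mul_assoc _ ‖𝓑.emb _‖]
      have := ht.1
      gcongr
      exact (𝓑.emb _).le_opNorm x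
    · have := ht.1
      exact LinearMap.mkContinuous_norm_le _ (by positivity) _
  choose U hU using key
  refine ⟨U, fun t ht0 ht c hca hcb x => ?_, C * ‖𝓑.emb (min_le_left a b)‖, by positivity,
    fun t ht0 ht => ?_⟩
  · have hc : c ≤ min a b := le_min hca hcb
    have := congrArg (𝓑.emb hc) ((hU t ht0 ht).1 x)
    rwa [𝓑.emb_comp, ← hE.consistent hc _ _ ht0.le, 𝓑.emb_comp] at this
  · refine (hU t ht0 ht).2.trans_eq ?_
    have : b - min a b = max (b - a) 0 := by
      rcases le_total a b with h | h <;> simp [h]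
    rw [this]
    ring

/-- The operator `S_t : B_a → B_b`, `0 < t ≤ 1`, for arbitrary indices `a`, `b`. -/
noncomputable def smoothing (hE : 𝓑.Generates E S) (a b : ℝ) : ℝ → B a →L[ℝ] B b :=
  (hE.exists_smoothing a b).choose

theorem emb_smoothing (hE : 𝓑.Generates E S) {a b c t : ℝ} (ht0 : 0 < t) (ht : t ≤ 1)
    (hca : c ≤ a) (hcb : c ≤ b) (x : B a) :
    𝓑.emb hcb (hE.smoothing a b t x) = S c t (𝓑.emb hca x) :=
  (hE.exists_smoothing a b).choose_spec.1 t ht0 ht c hca hcb x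

theorem exists_norm_smoothing_le (hE : 𝓑.Generates E S) (a b : ℝ) {τ : ℝ} (h : b - a ≤ τ)
    (hτ : 0 ≤ τ) :
    ∃ C : ℝ, 0 ≤ C ∧ ∀ t, 0 < t → t ≤ 1 → ∀ x, ‖hE.smoothing a b t x‖ ≤ C * t ^ (-τ) * ‖x‖ := by
  obtain ⟨C, hC, hU⟩ := (hE.exists_smoothing a b).choose_spec.2
  refine ⟨C, hC, fun t ht0 ht x => ((hE.smoothing a b t).le_opNorm x).trans ?_⟩
  gcongr
  refine (hU t ht0 ht).trans ?_
  gcongr ?_ * ?_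
  exact Real.rpow_le_rpow_of_exponent_ge ht0 ht (neg_le_neg (max_le h hτ))

theorem smoothing_eq_of_emb (hE : 𝓑.Generates E S) {a b c t : ℝ} (ht0 : 0 < t) (ht : t ≤ 1)
    (hca : c ≤ a) (hcb : c ≤ b) {x : B a} {y : B b} (hy : 𝓑.emb hcb y = S c t (𝓑.emb hca x)) :
    hE.smoothing a b t x = y :=
  𝓑.emb_injective hcb (by rw [hy, hE.emb_smoothing ht0 ht hca hcb])

theorem apply_smoothing (hE : 𝓑.Generates E S) {a b s t : ℝ} (hs0 : 0 ≤ s) (ht0 : 0 < t)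
    (hst : s + t ≤ 1) (x : B a) :
    S b s (hE.smoothing a b t x) = hE.smoothing a b (s + t) x := by
  symm
  refine hE.smoothing_eq_of_emb (by linarith) hst (min_le_left a b) (min_le_right a b) ?_
  rw [← hE.consistent _ _ _ hs0, hE.emb_smoothing ht0 (by linarith) (min_le_left a b),
    (hE.analytic _).add s t hs0 ht0.le]
  rfl

theorem smoothing_apply (hE : 𝓑.Generates E S) {a b s t : ℝ} (hs0 : 0 ≤ s) (ht0 : 0 < t)
    (hst : t + s ≤ 1) (x : B a) :
    hE.smoothing a b t (S a s x) = hE.smoothing a b (t + s) x := by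
  refine hE.smoothing_eq_of_emb ht0 (by linarith) (min_le_left a b) (min_le_right a b) ?_
  rw [hE.emb_smoothing (by linarith) hst (min_le_left a b), (hE.analytic _).add t s ht0.le hs0,
    ← hE.consistent _ _ _ hs0]
  rfl

theorem emb_smoothing_eq (hE : 𝓑.Generates E S) {a b c t : ℝ} (ht0 : 0 < t) (ht : t ≤ 1)
    (hcb : c ≤ b) (x : B a) :
    𝓑.emb hcb (hE.smoothing a b t x) = hE.smoothing a c t x := by
  symm
  refine hE.smoothing_eq_of_emb ht0 ht (min_le_left a c) (min_le_right a c) ?_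
  rw [𝓑.emb_comp, hE.emb_smoothing ht0 ht (min_le_left a c)]

theorem smoothing_emb (hE : 𝓑.Generates E S) {a b c t : ℝ} (ht0 : 0 < t) (ht : t ≤ 1)
    (hca : c ≤ a) (x : B a) :
    hE.smoothing c b t (𝓑.emb hca x) = hE.smoothing a b t x := by
  refine hE.smoothing_eq_of_emb ht0 ht (min_le_left c b) (min_le_right c b) ?_
  rw [𝓑.emb_comp, hE.emb_smoothing ht0 ht]

theorem lift_apply (hE : 𝓑.Generates E S) {a b t : ℝ} (ht0 : 0 < t) (ht : t ≤ 1)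
    (h : a ≤ b) (x : B a) : 𝓑.lift h (S a t x) = hE.smoothing a b t x := by
  have := hE.emb_smoothing ht0 ht le_rfl h x
  rw [𝓑.emb_refl] at this
  rw [← this, 𝓑.lift_emb]

end Generates

end InterpolationScale

/-! ### Young integration against a singular integrand -/

/-- The increment of a path over the dyadic interval `[n/2^k, (n+1)/2^k]`. -/
noncomputable def dyadicIncrement (w : ℝ≥0 → ℝ) (k n : ℕ) : ℝ :=
  w ((n + 1) / 2 ^ k) - w (n / 2 ^ k)

/-- The increments of the path over the dyadic intervals in `[0,1]` satisfy a Hölder bound with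
exponent `η` and constant `K`. Dyadic Riemann sums only see these increments. -/
def DyadicHolder (w : ℝ≥0 → ℝ) (η K : ℝ) : Prop :=
  ∀ k n : ℕ, n < 2 ^ k → |dyadicIncrement w k n| ≤ K * ((2 ^ k : ℝ)⁻¹) ^ η

theorem dyadicIncrement_add (w : ℝ≥0 → ℝ) (k n : ℕ) :
    dyadicIncrement w (k + 1) (2 * n) + dyadicIncrement w (k + 1) (2 * n + 1) =
      dyadicIncrement w k n := by
  have h : ∀ x : ℝ≥0, 2 * x / 2 ^ (k + 1) = x / 2 ^ k := fun x => by
    rw [pow_succ, mul_comm, mul_div_mul_right _ _ two_ne_zero]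
  unfold dyadicIncrement
  have h1 : ((2 * n + 1 : ℕ) + 1 : ℝ≥0) / 2 ^ (k + 1) = (n + 1) / 2 ^ k := by
    rw [← h]
    push_cast
    ring
  have h2 : ((2 * n : ℕ) : ℝ≥0) / 2 ^ (k + 1) = n / 2 ^ k := by
    rw [← h]
    push_cast
    ring
  rw [h1, h2]
  push_cast
  ring

theorem Nat.floor_two_mul_eq (y : ℝ) (hy : 0 ≤ y) :
    ⌊2 * y⌋₊ = 2 * ⌊y⌋₊ ∨ ⌊2 * y⌋₊ = 2 * ⌊y⌋₊ + 1 := by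
  have h1 := Nat.floor_le hy
  have h2 := Nat.lt_floor_add_one y
  have h3 : 2 * ⌊y⌋₊ ≤ ⌊2 * y⌋₊ := Nat.le_floor (by push_cast; linarith)
  have h4 : ⌊2 * y⌋₊ < 2 * ⌊y⌋₊ + 2 := (Nat.floor_lt (by positivity)).2 (by push_cast; linarith)
  omega

section Young

variable {X : Type*} [NormedAddCommGroup X] [NormedSpace ℝ X]

/-- The dyadic Riemann sum of `∫_s^t g dw`: the sum over the dyadic intervals of level `k` whose
right end point lies in `(s,t]`. -/
noncomputable def dyadicSum (w : ℝ≥0 → ℝ) (g : ℝ → X) (s t : ℝ) (k : ℕ) : X :=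
  ∑ n ∈ Finset.Ico ⌊s * 2 ^ k⌋₊ ⌊t * 2 ^ k⌋₊, dyadicIncrement w k n • g (n / 2 ^ k)

/-- Passing to the next dyadic level: besides the correction at the midpoints, at most one new
interval appears at the right end point. -/
theorem sum_range_dyadic_succ (w : ℝ≥0 → ℝ) (g : ℝ → X) {x : ℝ} (hx : 0 ≤ x) (k : ℕ) :
    ∃ e : X,
      ∑ n ∈ Finset.range ⌊x * 2 ^ (k + 1)⌋₊, dyadicIncrement w (k + 1) n • g (n / 2 ^ (k + 1)) =
        ∑ n ∈ Finset.range ⌊x * 2 ^ k⌋₊, dyadicIncrement w k n • g (n / 2 ^ k) +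
        ∑ n ∈ Finset.range ⌊x * 2 ^ k⌋₊, dyadicIncrement w (k + 1) (2 * n + 1) •
          (g ((2 * n + 1) / 2 ^ (k + 1)) - g (n / 2 ^ k)) + e ∧
      (e = 0 ∨ ∃ n : ℕ, ((n : ℝ) + 1) / 2 ^ (k + 1) ≤ x ∧
        e = dyadicIncrement w (k + 1) n • g (n / 2 ^ (k + 1))) := by
  have h0 : ∀ m : ℕ,
      ∑ n ∈ Finset.range (2 * m), dyadicIncrement w (k + 1) n • g (n / 2 ^ (k + 1)) =
        ∑ n ∈ Finset.range m, dyadicIncrement w k n • g (n / 2 ^ k) +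
        ∑ n ∈ Finset.range m, dyadicIncrement w (k + 1) (2 * n + 1) •
          (g ((2 * n + 1) / 2 ^ (k + 1)) - g (n / 2 ^ k)) := by
    intro m
    induction m with
    | zero => simp
    | succ m ih =>
      have h2 : ((2 * m : ℕ) : ℝ) / 2 ^ (k + 1) = m / 2 ^ k := by
        push_cast
        rw [pow_succ]
        field_simp
      rw [mul_add, mul_one, Finset.sum_range_succ, Finset.sum_range_succ, ih,
        Finset.sum_range_succ, Finset.sum_range_succ, h2, ← dyadicIncrement_add w k m]
      push_cast
      module
  have hf : x * 2 ^ (k + 1) = 2 * (x * 2 ^ k) := by ring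
  rw [hf]
  rcases Nat.floor_two_mul_eq (x * 2 ^ k) (by positivity) with h | h
  · exact ⟨0, by rw [h, h0, add_zero], Or.inl rfl⟩
  · refine ⟨_, by rw [h, Finset.sum_range_succ, h0], Or.inr ⟨_, ?_, rfl⟩⟩
    rw [div_le_iff₀ (by positivity), hf]
    have := Nat.floor_le (show 0 ≤ 2 * (x * 2 ^ k) by positivity)
    rw [h] at this
    exact_mod_cast this

/-- The bound of a single term of the Riemann sum: the distance of the left end point to the
singularity is at least the mesh size. -/
theorem norm_dyadicIncrement_smul_le {w : ℝ≥0 → ℝ} {η K N τ t : ℝ} (hw : DyadicHolder w η K)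
    (hK : 0 ≤ K) (hN : 0 ≤ N) (hτ : 0 ≤ τ) (ht : t ≤ 1) {g : ℝ → X}
    (hg : ∀ u, 0 ≤ u → u < t → ‖g u‖ ≤ N * (t - u) ^ (-τ)) {k n : ℕ}
    (hn : ((n : ℝ) + 1) / 2 ^ k ≤ t) :
    ‖dyadicIncrement w k n • g (n / 2 ^ k)‖ ≤ K * N * ((2 ^ k : ℝ)⁻¹) ^ (η - τ) := by
  have h2 : (0 : ℝ) < 2 ^ k := by positivity
  have hh : (0 : ℝ) < (2 ^ k : ℝ)⁻¹ := by positivity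
  have hn' : n < 2 ^ k := by
    have h1 := hn.trans ht
    rw [div_le_one h2] at h1
    have : n + 1 ≤ 2 ^ k := by exact_mod_cast h1
    omega
  have hdist : (2 ^ k : ℝ)⁻¹ ≤ t - n / 2 ^ k := by
    rw [add_div, one_div] at hn
    linarith
  rw [norm_smul, Real.norm_eq_abs]
  calc |dyadicIncrement w k n| * ‖g (n / 2 ^ k)‖
      ≤ (K * ((2 ^ k : ℝ)⁻¹) ^ η) * (N * ((2 ^ k : ℝ)⁻¹) ^ (-τ)) := by
        refine mul_le_mul (hw k n hn') ?_ (norm_nonneg _) (by positivity)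
        refine (hg _ (by positivity) (by linarith)).trans ?_
        exact mul_le_mul_of_nonneg_left
          (Real.rpow_le_rpow_of_nonpos hh hdist (by linarith)) hN
    _ = K * N * ((2 ^ k : ℝ)⁻¹) ^ (η - τ) := by
      rw [sub_eq_add_neg, Real.rpow_add hh]
      ring

theorem exists_sum_rpow_neg_le {ρ : ℝ} (hρ : 1 < ρ) :
    ∃ Z : ℝ, 0 ≤ Z ∧ ∀ a b : ℕ, ∑ n ∈ Finset.Ico a b, ((b - n : ℕ) : ℝ) ^ (-ρ) ≤ Z := by
  have hs : Summable fun n : ℕ => (n : ℝ) ^ (-ρ) := Real.summable_nat_rpow.2 (by linarith)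
  refine ⟨∑' n : ℕ, (n : ℝ) ^ (-ρ), tsum_nonneg fun n => by positivity, fun a b => ?_⟩
  have hinj : Set.InjOn (fun n => b - n) (Finset.Ico a b : Set ℕ) := by
    intro m hm n hn hmn
    simp only [Finset.coe_Ico, Set.mem_Ico] at hm hn hmn
    omega
  rw [← Finset.sum_image (f := fun n : ℕ => (n : ℝ) ^ (-ρ)) hinj]
  exact hs.sum_le_tsum _ fun n _ => by positivity

/-- The correction of the Riemann sum over `[s,t]` in passing from the level `k` to the level
`k + 1`. The exponent `ρ ≥ γ + τ`, `ρ > 1`, makes the series of the singular weights converge; the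
correction is summable in `k` if moreover `ρ < γ + η`. -/
theorem exists_norm_dyadicSum_succ_sub_le {γ η τ ρ : ℝ} (hτ : 0 ≤ τ)
    (hρ1 : 1 < ρ) (hρ : γ + τ ≤ ρ) :
    ∃ C : ℝ, 0 ≤ C ∧ ∀ (w : ℝ≥0 → ℝ) (K N : ℝ) (g : ℝ → X) (s t : ℝ) (k : ℕ),
      DyadicHolder w η K → 0 ≤ K → 0 ≤ N → 0 ≤ s → s < t → t ≤ 1 →
      (∀ u, 0 ≤ u → u < t → ‖g u‖ ≤ N * (t - u) ^ (-τ)) →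
      (∀ u v, 0 ≤ u → u ≤ v → v < t → ‖g v - g u‖ ≤ N * (t - v) ^ (-(γ + τ)) * (v - u) ^ γ) →
      (2 ^ k : ℝ)⁻¹ ≤ t - s →
      ‖dyadicSum w g s t (k + 1) - dyadicSum w g s t k‖ ≤
        C * (K * N) * (t - s) ^ (η - τ) * ((2 ^ (k + 1) : ℝ)⁻¹ / (t - s)) ^ (γ + η - ρ) := by
  obtain ⟨Z, hZ0, hZ⟩ := exists_sum_rpow_neg_le hρ1
  refine ⟨2 ^ (ρ - γ - τ) * Z + 2, by positivity, ?_⟩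
  intro w K N g s t k hw hK hN hs hst ht hg hg' hk
  set h : ℝ := (2 ^ (k + 1) : ℝ)⁻¹ with hh
  have hh0 : 0 < h := by positivity
  set L := t - s with hL
  have hL0 : 0 < L := by linarith
  have hhk : (2 ^ k : ℝ)⁻¹ = 2 * h := by
    rw [hh, pow_succ]
    field_simp
  rw [hhk] at hk
  have hu : ∀ n : ℕ, (n : ℝ) / 2 ^ k = n * (2 * h) := fun n => by rw [← hhk, div_eq_mul_inv]
  have hscale : h ^ (η - τ) ≤ L ^ (η - τ) * (h / L) ^ (γ + η - ρ) := by
    have e : h ^ (η - τ) = L ^ (η - τ) * (h / L) ^ (η - τ) := by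
      rw [← Real.mul_rpow hL0.le (by positivity), mul_div_cancel₀ _ hL0.ne']
    rw [e]
    refine mul_le_mul_of_nonneg_left ?_ (by positivity)
    refine Real.rpow_le_rpow_of_exponent_ge (by positivity) ?_ (by linarith)
    rw [div_le_one hL0]
    linarith
  obtain ⟨et, ht1, ht2⟩ := sum_range_dyadic_succ w g (hs.trans hst.le) k
  obtain ⟨es, hs1, hs2⟩ := sum_range_dyadic_succ w g hs k
  have hend : ∀ x e : _, x ≤ t → (e = 0 ∨ ∃ n : ℕ, ((n : ℝ) + 1) / 2 ^ (k + 1) ≤ x ∧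
      e = dyadicIncrement w (k + 1) n • g (n / 2 ^ (k + 1))) →
      ‖e‖ ≤ K * N * (L ^ (η - τ) * (h / L) ^ (γ + η - ρ)) := by
    rintro x e hx (rfl | ⟨n, hn, rfl⟩)
    · rw [norm_zero]
      positivity
    · exact (norm_dyadicIncrement_smul_le hw hK hN hτ ht hg (hn.trans hx)).trans
        (mul_le_mul_of_nonneg_left hscale (by positivity))
  have hle : ∀ j : ℕ, ⌊s * 2 ^ j⌋₊ ≤ ⌊t * 2 ^ j⌋₊ := fun j =>
    Nat.floor_le_floor (mul_le_mul_of_nonneg_right hst.le (by positivity))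
  have hdecomp : dyadicSum w g s t (k + 1) - dyadicSum w g s t k =
      ∑ n ∈ Finset.Ico ⌊s * 2 ^ k⌋₊ ⌊t * 2 ^ k⌋₊, dyadicIncrement w (k + 1) (2 * n + 1) •
          (g ((2 * n + 1) / 2 ^ (k + 1)) - g (n / 2 ^ k)) + (et - es) := by
    unfold dyadicSum
    rw [Finset.sum_Ico_eq_sub _ (hle _), Finset.sum_Ico_eq_sub _ (hle _),
      Finset.sum_Ico_eq_sub _ (hle _), ht1, hs1]
    abel
  have hterm : ∀ n ∈ Finset.Ico ⌊s * 2 ^ k⌋₊ ⌊t * 2 ^ k⌋₊,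
      ‖dyadicIncrement w (k + 1) (2 * n + 1) • (g ((2 * n + 1) / 2 ^ (k + 1)) - g (n / 2 ^ k))‖ ≤
        K * N * (2 ^ (ρ - γ - τ) * (L ^ (η - τ) * (h / L) ^ (γ + η - ρ))) *
          ((⌊t * 2 ^ k⌋₊ - n : ℕ) : ℝ) ^ (-ρ) := by
    intro n hn
    rw [Finset.mem_Ico] at hn
    set b := ⌊t * 2 ^ k⌋₊ with hb
    have hbt : (b : ℝ) * (2 * h) ≤ t := by
      rw [← hu, div_le_iff₀ (by positivity)]
      exact Nat.floor_le (by have := hs.trans hst.le; positivity)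
    have hsn : s - 2 * h ≤ n * (2 * h) := by
      have h1 : s * 2 ^ k < n + 1 := by
        have := Nat.lt_floor_add_one (s * 2 ^ k)
        have h3 : (⌊s * 2 ^ k⌋₊ : ℝ) ≤ n := by exact_mod_cast hn.1
        linarith
      have h2 : s < (n + 1) * (2 * h) := by
        rw [← hhk, ← div_eq_mul_inv, lt_div_iff₀ (by positivity)]
        exact h1
      linarith
    have hbn : (1 : ℝ) ≤ ((b - n : ℕ) : ℝ) := by
      have : 1 ≤ b - n := by omega
      exact_mod_cast this
    have hcast : ((b - n : ℕ) : ℝ) = b - n := by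
      rw [Nat.cast_sub hn.2.le]
    have hm : (2 * (n : ℝ) + 1) / 2 ^ (k + 1) = n * (2 * h) + h := by
      rw [hh]
      field_simp
    rw [hm, hu]
    set m := n * (2 * h) + h with hm'
    have htm : ((b - n : ℕ) : ℝ) * h ≤ t - m := by
      rw [hcast] at hbn ⊢
      nlinarith
    have htm0 : 0 < t - m := lt_of_lt_of_le (by positivity) htm
    have htm2 : t - m ≤ 2 * L := by linarith
    have hinc : |dyadicIncrement w (k + 1) (2 * n + 1)| ≤ K * h ^ η := by
      apply hw
      have h1 : (n : ℝ) + 1 ≤ b := by exact_mod_cast hn.2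
      have h2 : ((2 * n + 1 : ℕ) : ℝ) < 2 ^ (k + 1) := by
        have h3 : ((2 * n + 1 : ℕ) : ℝ) * h < 1 := by
          push_cast
          nlinarith
        rwa [hh, ← div_eq_mul_inv, div_lt_one (by positivity)] at h3
      exact_mod_cast h2
    have hgm := hg' (n * (2 * h)) m (by positivity) (by linarith) (by linarith)
    rw [show m - n * (2 * h) = h by rw [hm']; ring] at hgm
    have hsing : (t - m) ^ (-(γ + τ)) ≤
        (((b - n : ℕ) : ℝ) ^ (-ρ) * h ^ (-ρ)) * (2 ^ (ρ - γ - τ) * L ^ (ρ - γ - τ)) := by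
      have e : (t - m) ^ (-(γ + τ)) = (t - m) ^ (-ρ) * (t - m) ^ (ρ - γ - τ) := by
        rw [← Real.rpow_add htm0]
        congr 1
        ring
      rw [e, ← Real.mul_rpow (by positivity) hh0.le, ← Real.mul_rpow (by positivity) hL0.le]
      refine mul_le_mul ?_ ?_ (by positivity) (by positivity)
      · exact Real.rpow_le_rpow_of_nonpos (by positivity) htm (by linarith)
      · exact Real.rpow_le_rpow htm0.le htm2 (by linarith)
    have hpow : L ^ (ρ - γ - τ) * h ^ (γ + η - ρ) = L ^ (η - τ) * (h / L) ^ (γ + η - ρ) := by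
      rw [Real.div_rpow hh0.le hL0.le, show η - τ = (ρ - γ - τ) + (γ + η - ρ) by ring,
        Real.rpow_add hL0]
      field_simp
    rw [norm_smul, Real.norm_eq_abs]
    calc _ ≤ (K * h ^ η) * (N * (t - m) ^ (-(γ + τ)) * h ^ γ) :=
          mul_le_mul hinc hgm (norm_nonneg _) (by positivity)
      _ ≤ (K * h ^ η) * (N * ((((b - n : ℕ) : ℝ) ^ (-ρ) * h ^ (-ρ)) *
            (2 ^ (ρ - γ - τ) * L ^ (ρ - γ - τ))) * h ^ γ) := by gcongr
      _ = K * N * (2 ^ (ρ - γ - τ) * (L ^ (ρ - γ - τ) * (h ^ γ * h ^ η * h ^ (-ρ)))) *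
            ((b - n : ℕ) : ℝ) ^ (-ρ) := by ring
      _ = _ := by
        rw [← Real.rpow_add hh0, ← Real.rpow_add hh0, ← sub_eq_add_neg, hpow]
  rw [hdecomp]
  calc _ ≤ ∑ n ∈ Finset.Ico ⌊s * 2 ^ k⌋₊ ⌊t * 2 ^ k⌋₊,
        K * N * (2 ^ (ρ - γ - τ) * (L ^ (η - τ) * (h / L) ^ (γ + η - ρ))) *
          ((⌊t * 2 ^ k⌋₊ - n : ℕ) : ℝ) ^ (-ρ) +
        (K * N * (L ^ (η - τ) * (h / L) ^ (γ + η - ρ)) +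
          K * N * (L ^ (η - τ) * (h / L) ^ (γ + η - ρ))) := by
        refine (norm_add_le _ _).trans (add_le_add ((norm_sum_le _ _).trans ?_)
          ((norm_sub_le _ _).trans (add_le_add ?_ ?_)))
        · exact Finset.sum_le_sum hterm
        · exact hend t et le_rfl ht2
        · exact hend s es hst.le hs2
    _ ≤ K * N * (2 ^ (ρ - γ - τ) * (L ^ (η - τ) * (h / L) ^ (γ + η - ρ))) * Z +
        (K * N * (L ^ (η - τ) * (h / L) ^ (γ + η - ρ)) +
          K * N * (L ^ (η - τ) * (h / L) ^ (γ + η - ρ))) := by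
        rw [← Finset.mul_sum]
        gcongr
        exact hZ _ _
    _ = _ := by ring

/-- Young's estimate for an integrand with a singularity at the upper end point `t`: if
`‖g u‖ ≤ N (t-u)^{-τ}` and `‖g v - g u‖ ≤ N (t-v)^{-(γ+τ)} (v-u)^γ`, with `τ < η` and
`γ + η > 1`, then the dyadic Riemann sums over `[s,t]` converge, and the limit is of order
`(t-s)^{η-τ}`. -/
theorem exists_tendsto_dyadicSum [CompleteSpace X] {γ η τ : ℝ} (hτ : 0 ≤ τ)
    (hτη : τ < η) (hγη : 1 < γ + η) :
    ∃ C : ℝ, 0 ≤ C ∧ ∀ (w : ℝ≥0 → ℝ) (K N : ℝ) (g : ℝ → X) (s t : ℝ),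
      DyadicHolder w η K → 0 ≤ K → 0 ≤ N → 0 ≤ s → s < t → t ≤ 1 →
      (∀ u, 0 ≤ u → u < t → ‖g u‖ ≤ N * (t - u) ^ (-τ)) →
      (∀ u v, 0 ≤ u → u ≤ v → v < t → ‖g v - g u‖ ≤ N * (t - v) ^ (-(γ + τ)) * (v - u) ^ γ) →
      ∃ J : X, Tendsto (dyadicSum w g s t) atTop (𝓝 J) ∧
        ‖J‖ ≤ C * (K * N) * (t - s) ^ (η - τ) := by
  set ρ := max (γ + τ) ((1 + γ + η) / 2) with hρ
  have hρ1 : 1 < ρ := lt_max_of_lt_right (by linarith)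
  have hργη : ρ < γ + η := max_lt (by linarith) (by linarith)
  obtain ⟨C, hC, hstep⟩ := exists_norm_dyadicSum_succ_sub_le (X := X) (η := η) hτ hρ1
    (le_max_left _ _)
  set κ := γ + η - ρ with hκ
  have hκ0 : 0 < κ := by linarith
  set r : ℝ := (1 / 2) ^ κ with hr
  have hr1 : r < 1 := Real.rpow_lt_one (by norm_num) (by norm_num) hκ0
  have hr1' : 0 < 1 - r := by linarith
  refine ⟨3 + C / (1 - r), by positivity, ?_⟩
  intro w K N g s t hw hK hN hs hst ht hg hg'
  set L := t - s with hL
  have hL0 : 0 < L := by linarith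
  -- the first level whose mesh size is below the length of the interval
  obtain ⟨k₀, hk1, hk2⟩ : ∃ k₀ : ℕ, (2 ^ k₀ : ℝ)⁻¹ ≤ L ∧ L ≤ 2 * (2 ^ k₀ : ℝ)⁻¹ := by
    obtain ⟨n, hn1, hn2⟩ := exists_nat_pow_near_of_lt_one hL0 (by linarith : L ≤ 1)
      (by norm_num : (0 : ℝ) < 2⁻¹) (by norm_num)
    refine ⟨n + 1, ?_, ?_⟩
    · rw [← inv_pow]
      exact hn1.le
    · rw [← inv_pow, pow_succ]
      linarith
  have hmono : ∀ j : ℕ, (2 ^ (k₀ + j) : ℝ)⁻¹ ≤ L * (1 / 2) ^ j := by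
    intro j
    rw [pow_add, mul_inv, one_div, inv_pow]
    gcongr
  have hbase : ‖dyadicSum w g s t k₀‖ ≤ 3 * (K * N) * L ^ (η - τ) := by
    have hcard : ((⌊t * 2 ^ k₀⌋₊ - ⌊s * 2 ^ k₀⌋₊ : ℕ) : ℝ) ≤ 3 := by
      have h1 := Nat.floor_le (show 0 ≤ t * 2 ^ k₀ by have := hs.trans hst.le; positivity)
      have h2 := Nat.lt_floor_add_one (s * 2 ^ k₀)
      have h3 : L * 2 ^ k₀ ≤ 2 := by
        have := mul_le_mul_of_nonneg_right hk2 (show (0 : ℝ) ≤ 2 ^ k₀ by positivity)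
        rwa [mul_assoc, inv_mul_cancel₀ (by positivity), mul_one] at this
      rw [Nat.cast_sub (Nat.floor_le_floor (mul_le_mul_of_nonneg_right hst.le (by positivity)))]
      rw [hL, sub_mul] at h3
      linarith
    refine (norm_sum_le _ _).trans ?_
    calc _ ≤ ∑ n ∈ Finset.Ico ⌊s * 2 ^ k₀⌋₊ ⌊t * 2 ^ k₀⌋₊, K * N * L ^ (η - τ) := by
          refine Finset.sum_le_sum fun n hn => ?_
          rw [Finset.mem_Ico] at hn
          refine (norm_dyadicIncrement_smul_le hw hK hN hτ ht hg ?_).trans ?_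
          · rw [div_le_iff₀ (by positivity)]
            have h1 := Nat.floor_le (show 0 ≤ t * 2 ^ k₀ by have := hs.trans hst.le; positivity)
            have h2 : (n : ℝ) + 1 ≤ ⌊t * 2 ^ k₀⌋₊ := by exact_mod_cast hn.2
            linarith
          · exact mul_le_mul_of_nonneg_left
              (Real.rpow_le_rpow (by positivity) hk1 (by linarith)) (by positivity)
      _ ≤ 3 * (K * N * L ^ (η - τ)) := by
          rw [Finset.sum_const, Nat.card_Ico, nsmul_eq_mul]
          gcongr
      _ = 3 * (K * N) * L ^ (η - τ) := by ring
  have hgeo : ∀ j : ℕ, dist (dyadicSum w g s t (k₀ + j)) (dyadicSum w g s t (k₀ + (j + 1))) ≤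
      C * (K * N) * L ^ (η - τ) * r ^ j := by
    intro j
    rw [dist_comm, dist_eq_norm]
    have hpow : ((1 : ℝ) / 2) ^ j ≤ 1 := pow_le_one₀ (by norm_num) (by norm_num)
    refine (hstep w K N g s t (k₀ + j) hw hK hN hs hst ht hg hg' ?_).trans ?_
    · exact (hmono j).trans (mul_le_of_le_one_right hL0.le hpow)
    · have h1 : (2 ^ (k₀ + j + 1) : ℝ)⁻¹ / L ≤ (1 / 2) ^ j := by
        rw [div_le_iff₀ hL0, mul_comm]
        refine le_trans ?_ (hmono j)
        exact inv_anti₀ (by positivity) (pow_le_pow_right₀ (by norm_num) (by omega))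
      have h2 : r ^ j = ((1 / 2 : ℝ) ^ j) ^ κ := by
        rw [hr, ← Real.rpow_natCast, ← Real.rpow_natCast, ← Real.rpow_mul (by norm_num),
          ← Real.rpow_mul (by norm_num), mul_comm]
      rw [h2]
      gcongr
  obtain ⟨J, hJ⟩ := cauchySeq_tendsto_of_complete (cauchySeq_of_le_geometric r _ hr1 hgeo)
  refine ⟨J, ?_, ?_⟩
  · rw [← tendsto_add_atTop_iff_nat k₀]
    simpa [add_comm] using hJ
  · have h1 := dist_le_of_le_geometric_of_tendsto₀ r _ hr1 hgeo hJ
    rw [dist_eq_norm, add_zero] at h1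
    calc ‖J‖ = ‖dyadicSum w g s t k₀ - (dyadicSum w g s t k₀ - J)‖ := by rw [sub_sub_cancel]
      _ ≤ 3 * (K * N) * L ^ (η - τ) + C * (K * N) * L ^ (η - τ) / (1 - r) :=
        (norm_sub_le _ _).trans (add_le_add hbase h1)
      _ = _ := by ring

end Young

/-! ### Stochastic convolutions and drift convolutions -/

/-- A function with a modulus of continuity `ω` is continuous. -/
theorem continuousOn_of_norm_sub_le {X : Type*} [NormedAddCommGroup X] {f : ℝ → X} {s : Set ℝ}
    {ω : ℝ → ℝ} (hω : Continuous ω) (hω0 : ω 0 = 0)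
    (h : ∀ x ∈ s, ∀ y ∈ s, x ≤ y → ‖f y - f x‖ ≤ ω (y - x)) : ContinuousOn f s := by
  intro x hx
  rw [ContinuousWithinAt, tendsto_iff_norm_sub_tendsto_zero]
  have h2 : Tendsto (fun y : ℝ => ω |y - x|) (𝓝[s] x) (𝓝 0) :=
    (Continuous.tendsto' (by fun_prop) x 0 (by simp [hω0])).mono_left nhdsWithin_le_nhds
  refine squeeze_zero' (Eventually.of_forall fun t => norm_nonneg _) ?_ h2
  filter_upwards [self_mem_nhdsWithin] with y hy
  rcases le_total x y with hxy | hxy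
  · rw [abs_of_nonneg (by linarith)]
    exact h x hx y hy hxy
  · rw [norm_sub_rev, abs_sub_comm, abs_of_nonneg (by linarith)]
    exact h y hy x hx hxy

theorem intervalIntegral.integral_congr_Ioo {X : Type*} [NormedAddCommGroup X] [NormedSpace ℝ X]
    {f g : ℝ → X} {s t : ℝ} (hst : s ≤ t) (h : EqOn f g (Ioo s t)) :
    ∫ r in s..t, f r = ∫ r in s..t, g r := by
  rw [intervalIntegral.integral_of_le hst, intervalIntegral.integral_of_le hst,
    ← restrict_Ioo_eq_restrict_Ioc]
  exact setIntegral_congr_fun measurableSet_Ioo h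

section dyadicSum

variable {X Y : Type*} [NormedAddCommGroup X] [NormedSpace ℝ X] [NormedAddCommGroup Y]
  [NormedSpace ℝ Y]

theorem dyadicSum_congr (w : ℝ≥0 → ℝ) {f g : ℝ → X} {s t : ℝ}
    (h : ∀ u, 0 ≤ u → u < t → f u = g u) (k : ℕ) : dyadicSum w f s t k = dyadicSum w g s t k := by
  refine Finset.sum_congr rfl fun n hn => ?_
  rw [Finset.mem_Ico] at hn
  rw [h _ (by positivity)]
  rw [div_lt_iff₀ (by positivity)]
  exact Nat.lt_of_lt_floor hn.2

theorem map_dyadicSum (L : X →L[ℝ] Y) (w : ℝ≥0 → ℝ) (g : ℝ → X) (s t : ℝ) (k : ℕ) :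
    L (dyadicSum w g s t k) = dyadicSum w (fun u => L (g u)) s t k := by
  simp [dyadicSum, map_sum]

theorem dyadicSum_zero_add (w : ℝ≥0 → ℝ) (g : ℝ → X) {s t : ℝ} (hst : s ≤ t) (k : ℕ) :
    dyadicSum w g 0 s k + dyadicSum w g s t k = dyadicSum w g 0 t k := by
  refine Finset.sum_Ico_consecutive _ (by simp) (Nat.floor_le_floor ?_)
  gcongr

end dyadicSum

namespace InterpolationScale

variable {B : ℝ → Type*} [∀ a, NormedAddCommGroup (B a)] [∀ a, NormedSpace ℝ (B a)]

/-- `y` is bounded by `N` in the norm of `C([0,T]; B_b) ∩ C^γ([0,T]; B_a)`: its supremum in `B_b`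
and its Hölder seminorm in `B_a` are at most `N`. Continuity in `B_b` is not included. -/
def VBound (𝓑 : InterpolationScale B) {a b : ℝ} (h : a ≤ b) (γ T N : ℝ) (y : ℝ → B b) : Prop :=
  (∀ t ∈ Icc 0 T, ‖y t‖ ≤ N) ∧
    ∀ s ∈ Icc 0 T, ∀ t ∈ Icc 0 T, s ≤ t → ‖𝓑.emb h (y t - y s)‖ ≤ N * (t - s) ^ γ

/-- `Φ` is a convolution with the semigroup on `[0,T]`: `Φ_t - S_{t-s} Φ_s`, the contribution of
the time interval `[s,t]`, lies in the smaller space `B_c`, with norm of order `(t-s)^κ`, and its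
norm in the larger space `B_a` is of order `(t-s)^{γ+κ}`. -/
def MildBound (𝓑 : InterpolationScale B) (S : ∀ a : ℝ, ℝ → B a →L[ℝ] B a) {a b c : ℝ} (hab : a ≤ b)
    (hbc : b ≤ c) (γ κ N T : ℝ) (Φ : ℝ → B b) : Prop :=
  ∀ s t, 0 ≤ s → s ≤ t → t ≤ T → ∃ ψ : B c, Φ t = S b (t - s) (Φ s) + 𝓑.emb hbc ψ ∧
    ‖ψ‖ ≤ N * (t - s) ^ κ ∧ ‖𝓑.emb (hab.trans hbc) ψ‖ ≤ N * (t - s) ^ (γ + κ)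

variable {𝓑 : InterpolationScale B} {E : ∀ a : ℝ, B (a + 1) →L[ℝ] B a} {S : ∀ a : ℝ, ℝ → B a →L[ℝ] B a}

theorem VBound.mono {a b : ℝ} {h : a ≤ b} {γ T T' N N' : ℝ} {y : ℝ → B b}
    (hy : 𝓑.VBound h γ T N y) (hT : T' ≤ T) (hN : N ≤ N') : 𝓑.VBound h γ T' N' y := by
  refine ⟨fun t ht => (hy.1 t ⟨ht.1, ht.2.trans hT⟩).trans hN, fun s hs t ht hst => ?_⟩
  refine (hy.2 s ⟨hs.1, hs.2.trans hT⟩ t ⟨ht.1, ht.2.trans hT⟩ hst).trans ?_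
  exact mul_le_mul_of_nonneg_right hN (Real.rpow_nonneg (by linarith) _)

theorem VBound.add {a b : ℝ} {h : a ≤ b} {γ T N N' : ℝ} {y z : ℝ → B b}
    (hy : 𝓑.VBound h γ T N y) (hz : 𝓑.VBound h γ T N' z) :
    𝓑.VBound h γ T (N + N') (fun t => y t + z t) := by
  refine ⟨fun t ht => (norm_add_le _ _).trans (add_le_add (hy.1 t ht) (hz.1 t ht)),
    fun s hs t ht hst => ?_⟩
  rw [add_sub_add_comm, map_add, add_mul]
  exact (norm_add_le _ _).trans (add_le_add (hy.2 s hs t ht hst) (hz.2 s hs t ht hst))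

theorem VBound.neg {a b : ℝ} {h : a ≤ b} {γ T N : ℝ} {y : ℝ → B b}
    (hy : 𝓑.VBound h γ T N y) : 𝓑.VBound h γ T N (fun t => -y t) := by
  refine ⟨fun t ht => by rw [norm_neg]; exact hy.1 t ht, fun s hs t ht hst => ?_⟩
  rw [← neg_sub', map_neg, norm_neg]
  exact hy.2 s hs t ht hst

theorem VBound.congr {a b : ℝ} {h : a ≤ b} {γ T N : ℝ} {y z : ℝ → B b}
    (hy : 𝓑.VBound h γ T N y) (hyz : EqOn y z (Icc 0 T)) : 𝓑.VBound h γ T N z :=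
  ⟨fun t ht => hyz ht ▸ hy.1 t ht, fun s hs t ht hst => hyz ht ▸ hyz hs ▸ hy.2 s hs t ht hst⟩

theorem MildBound.add {a b c : ℝ} {hab : a ≤ b} {hbc : b ≤ c} {γ κ N N' T : ℝ} {Φ Ψ : ℝ → B b}
    (hΦ : 𝓑.MildBound S hab hbc γ κ N T Φ) (hΨ : 𝓑.MildBound S hab hbc γ κ N' T Ψ) :
    𝓑.MildBound S hab hbc γ κ (N + N') T (fun t => Φ t + Ψ t) := by
  intro s t hs hst ht
  obtain ⟨φ, h1, h2, h3⟩ := hΦ s t hs hst ht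
  obtain ⟨ψ, h4, h5, h6⟩ := hΨ s t hs hst ht
  refine ⟨φ + ψ, ?_, ?_, ?_⟩
  · simp only [h1, h4, map_add]
    abel
  · rw [add_mul]
    exact (norm_add_le _ _).trans (add_le_add h2 h5)
  · rw [add_mul, map_add]
    exact (norm_add_le _ _).trans (add_le_add h3 h6)

theorem MildBound.neg {a b c : ℝ} {hab : a ≤ b} {hbc : b ≤ c} {γ κ N T : ℝ} {Φ : ℝ → B b}
    (hΦ : 𝓑.MildBound S hab hbc γ κ N T Φ) :
    𝓑.MildBound S hab hbc γ κ N T (fun t => -Φ t) := by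
  intro s t hs hst ht
  obtain ⟨φ, h1, h2, h3⟩ := hΦ s t hs hst ht
  refine ⟨-φ, ?_, by rwa [norm_neg], by rwa [map_neg, norm_neg]⟩
  simp only [h1, map_neg]
  abel

namespace Generates

/-- A convolution with the semigroup that vanishes on `[0,τ]` lies in
`C([0,T]; B_b) ∩ C^γ([0,T]; B_a)`, and is small there if `T - τ` is small. -/
theorem exists_vBound_of_mildBound (hE : 𝓑.Generates E S) {a b c γ κ : ℝ} (hab : a ≤ b)
    (hbc : b < c) (hγ : b - a = γ) (hγ1 : γ ≤ 1) (hbc1 : c ≤ b + 1) (hκ : 0 < κ) :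
    ∃ C : ℝ, 0 ≤ C ∧ ∀ (N T τ : ℝ) (Φ : ℝ → B b), 0 ≤ N → T ≤ 1 → 0 ≤ τ → τ ≤ T →
      𝓑.MildBound S hab hbc.le γ κ N T Φ → (∀ t ∈ Icc 0 τ, Φ t = 0) →
      ContinuousOn Φ (Icc 0 T) ∧ 𝓑.VBound hab γ T (C * N * (T - τ) ^ κ) Φ := by
  obtain ⟨C₁, hC₁, hemb⟩ := 𝓑.exists_norm_emb_le hbc.le
  obtain ⟨C₂, hC₂, htime⟩ := hE.exists_norm_sub_le hab (by linarith)
  obtain ⟨C₃, hC₃, htime'⟩ := hE.exists_norm_sub_le hbc.le hbc1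
  rw [hγ] at htime
  refine ⟨C₁ + C₂ * C₁ + 1, by positivity, ?_⟩
  intro N T τ Φ hN hT hτ0 hτT hΦ hzero
  have hγ0 : 0 ≤ γ := by linarith
  have hstart : ∀ r t, r ∈ Icc 0 τ → r ≤ t → t ≤ T → ∃ φ : B c, Φ t = 𝓑.emb hbc.le φ ∧
      ‖φ‖ ≤ N * (t - r) ^ κ := by
    intro r t hr hrt ht
    obtain ⟨ψ, h1, h2, -⟩ := hΦ r t hr.1 hrt ht
    refine ⟨ψ, ?_, h2⟩
    rw [h1, hzero r hr, map_zero, zero_add]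
  have hsup : ∀ t ∈ Icc 0 T, ‖Φ t‖ ≤ C₁ * N * (T - τ) ^ κ := by
    intro t ht
    rcases le_total t τ with h | h
    · rw [hzero t ⟨ht.1, h⟩, norm_zero]
      have : 0 ≤ T - τ := by linarith
      positivity
    · obtain ⟨φ, h1, h2⟩ := hstart τ t ⟨hτ0, le_rfl⟩ h ht.2
      rw [h1]
      refine (hemb φ).trans ?_
      rw [mul_assoc]
      refine mul_le_mul_of_nonneg_left (h2.trans ?_) hC₁
      refine mul_le_mul_of_nonneg_left ?_ hN
      exact Real.rpow_le_rpow (by linarith) (by linarith [ht.2]) hκ.le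
  refine ⟨?_, fun t ht => (hsup t ht).trans ?_, ?_⟩
  · refine continuousOn_of_norm_sub_le (ω := fun r => C₃ * r ^ (c - b) * N + C₁ * N * r ^ κ) ?_ ?_ ?_
    · have h1 : Continuous fun r : ℝ => r ^ (c - b) := Real.continuous_rpow_const (by linarith)
      have h2 : Continuous fun r : ℝ => r ^ κ := Real.continuous_rpow_const hκ.le
      fun_prop
    · simp [Real.zero_rpow hκ.ne', Real.zero_rpow (sub_pos.2 hbc).ne']
    · intro s hs t ht hst
      obtain ⟨φ, h1, h2⟩ := hstart 0 s ⟨le_rfl, hτ0⟩ hs.1 hs.2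
      obtain ⟨ψ, h3, h4, -⟩ := hΦ s t hs.1 hst ht.2
      have h5 : ‖φ‖ ≤ N := by
        refine h2.trans (mul_le_of_le_one_right hN ?_)
        exact Real.rpow_le_one (by linarith [hs.1]) (by linarith [hs.2]) hκ.le
      have h6 : Φ t - Φ s = (S b (t - s) (𝓑.emb hbc.le φ) - 𝓑.emb hbc.le φ) + 𝓑.emb hbc.le ψ := by
        rw [h3, ← h1]
        abel
      rw [h6]
      refine (norm_add_le _ _).trans (add_le_add ?_ ?_)
      · refine (htime' (t - s) (by linarith) (by linarith [ht.2, hs.1]) φ).trans ?_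
        have : 0 ≤ t - s := by linarith
        gcongr
      · refine (hemb ψ).trans ?_
        rw [mul_assoc]
        gcongr
  · have : 0 ≤ (T - τ) ^ κ := Real.rpow_nonneg (by linarith) _
    gcongr
    nlinarith [mul_nonneg hC₂ hC₁]
  · -- the Hölder bound on `[s,t]` with `τ ≤ s`
    have key : ∀ s ∈ Icc τ T, ∀ t ∈ Icc s T, ‖𝓑.emb hab (Φ t - Φ s)‖ ≤
        (C₁ + C₂ * C₁ + 1) * N * (T - τ) ^ κ * (t - s) ^ γ := by
      intro s hs t ht
      have hst : 0 ≤ t - s := by linarith [ht.1]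
      have hTτ : 0 ≤ T - τ := by linarith
      obtain ⟨ψ, h1, -, h2⟩ := hΦ s t (hτ0.trans hs.1) ht.1 ht.2
      have h3 : 𝓑.emb hab (Φ t - Φ s) =
          (S a (t - s) (𝓑.emb hab (Φ s)) - 𝓑.emb hab (Φ s)) + 𝓑.emb (hab.trans hbc.le) ψ := by
        rw [h1, hE.consistent hab _ _ hst, ← 𝓑.emb_comp hab hbc.le]
        simp only [map_add, map_sub]
        abel
      rw [h3]
      calc _ ≤ C₂ * (t - s) ^ γ * (C₁ * N * (T - τ) ^ κ) + N * ((t - s) ^ γ * (T - τ) ^ κ) := by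
            refine (norm_add_le _ _).trans (add_le_add ?_ (h2.trans ?_))
            · refine (htime (t - s) hst (by linarith [ht.2, hs.1]) _).trans ?_
              gcongr
              exact hsup s ⟨hτ0.trans hs.1, hs.2⟩
            · rw [Real.rpow_add_of_nonneg hst hγ0 hκ.le]
              have : t - s ≤ T - τ := by linarith [ht.2, hs.1]
              gcongr
        _ = (C₂ * C₁ + 1) * N * (T - τ) ^ κ * (t - s) ^ γ := by ring
        _ ≤ _ := by
          gcongr
          linarith
    intro s hs t ht hst
    rcases le_total t τ with h | h
    · rw [hzero t ⟨ht.1, h⟩, hzero s ⟨hs.1, hst.trans h⟩, sub_zero, map_zero, norm_zero]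
      have h1 : 0 ≤ t - s := by linarith
      have h2 : 0 ≤ T - τ := by linarith
      positivity
    · rcases le_total s τ with h' | h'
      · have h1 := key τ ⟨le_rfl, hτT⟩ t ⟨h, ht.2⟩
        rw [hzero τ ⟨hτ0, le_rfl⟩, ← hzero s ⟨hs.1, h'⟩] at h1
        refine h1.trans ?_
        have h2 : 0 ≤ T - τ := by linarith
        have h3 : 0 ≤ t - τ := by linarith
        gcongr
      · exact key s ⟨h', hs.2⟩ t ⟨hst, ht.2⟩

theorem youngSum_eq_dyadicSum (hE : 𝓑.Generates E S) {p b : ℝ} (hpb : p ≤ b) (w : ℝ≥0 → ℝ)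
    (Y : ℝ → B p) {t : ℝ} (ht : t ≤ 1) (k : ℕ) :
    𝓑.youngSum S hpb w Y t k = dyadicSum w (fun u => hE.smoothing p b (t - u) (Y u)) 0 t k := by
  have h : dyadicSum w (fun u => hE.smoothing p b (t - u) (Y u)) 0 t k =
      dyadicSum w (fun u => 𝓑.lift hpb (S p (t - u) (Y u))) 0 t k :=
    dyadicSum_congr w (fun u hu hut =>
      (hE.lift_apply (by linarith) (by linarith) hpb (Y u)).symm) k
  rw [h]
  simp [youngSum, dyadicSum, dyadicIncrement]

variable [∀ a, CompleteSpace (B a)]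

/-- Young's estimate for `∫_s^t S_{t-u} Y_u dw_u` in `B_c`, where `Y` is bounded in `B_p` and
`γ`-Hölder in `B_q`, `q = p - γ`. -/
theorem exists_young_estimate (hE : 𝓑.Generates E S) {p q c γ η τ : ℝ} (hqp : q ≤ p)
    (hγ : p - q = γ) (hγ1 : γ ≤ 1) (hc : c - p ≤ τ) (hτ : 0 ≤ τ) (hτη : τ < η) (hγη : 1 < γ + η) :
    ∃ C : ℝ, 0 ≤ C ∧ ∀ (w : ℝ≥0 → ℝ) (K N T : ℝ) (Y : ℝ → B p) (s t : ℝ), DyadicHolder w η K →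
      0 ≤ K → 0 ≤ N → T ≤ 1 → 𝓑.VBound hqp γ T N Y → 0 ≤ s → s < t → t ≤ T →
      ∃ J : B c, Tendsto (dyadicSum w (fun u => hE.smoothing p c (t - u) (Y u)) s t) atTop (𝓝 J) ∧
        ‖J‖ ≤ C * K * N * (t - s) ^ (η - τ) := by
  have hγ0 : 0 ≤ γ := by linarith
  obtain ⟨C, hC, hyoung⟩ := exists_tendsto_dyadicSum (X := B c) hτ hτη hγη
  obtain ⟨C₁, hC₁, hU₁⟩ := hE.exists_norm_smoothing_le p c hc hτ
  obtain ⟨C₂, hC₂, hU₂⟩ := hE.exists_norm_smoothing_le q c (τ := γ + τ) (by linarith) (by linarith)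
  obtain ⟨C₃, hC₃, htime⟩ := hE.exists_norm_sub_le hqp (by linarith)
  rw [hγ] at htime
  refine ⟨C * (C₁ + C₂ * (1 + C₃)), by positivity, ?_⟩
  intro w K N T Y s t hw hK hN hT hY hs hst ht
  have hbound : ∀ u, 0 ≤ u → u < t → ‖hE.smoothing p c (t - u) (Y u)‖ ≤
      (C₁ + C₂ * (1 + C₃)) * N * (t - u) ^ (-τ) := by
    intro u hu hut
    refine (hU₁ (t - u) (by linarith) (by linarith) _).trans ?_
    have h1 := hY.1 u ⟨hu, by linarith⟩
    have h2 : 0 ≤ (t - u) ^ (-τ) := Real.rpow_nonneg (by linarith) _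
    calc C₁ * (t - u) ^ (-τ) * ‖Y u‖ ≤ (C₁ + C₂ * (1 + C₃)) * (t - u) ^ (-τ) * N := by
          gcongr
          nlinarith
      _ = _ := by ring
  have hincr : ∀ u v, 0 ≤ u → u ≤ v → v < t →
      ‖hE.smoothing p c (t - v) (Y v) - hE.smoothing p c (t - u) (Y u)‖ ≤
      (C₁ + C₂ * (1 + C₃)) * N * (t - v) ^ (-(γ + τ)) * (v - u) ^ γ := by
    intro u v hu huv hvt
    have htv : 0 < t - v := by linarith
    have e1 : hE.smoothing p c (t - v) (Y v) - hE.smoothing p c (t - u) (Y u) =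
        hE.smoothing q c (t - v) (𝓑.emb hqp (Y v - Y u) -
          (S q (v - u) (𝓑.emb hqp (Y u)) - 𝓑.emb hqp (Y u))) := by
      have e2 : t - u = (t - v) + (v - u) := by ring
      rw [e2, ← hE.smoothing_apply (by linarith) htv (by linarith),
        ← hE.smoothing_emb htv (by linarith) hqp, ← hE.smoothing_emb htv (by linarith) hqp,
        ← map_sub, hE.consistent hqp _ _ (by linarith)]
      congr 1
      rw [map_sub]
      abel
    rw [e1]
    refine (hU₂ (t - v) htv (by linarith) _).trans ?_
    have h1 : 0 ≤ (t - v) ^ (-(γ + τ)) := Real.rpow_nonneg htv.le _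
    have h2 : 0 ≤ (v - u) ^ γ := Real.rpow_nonneg (by linarith) _
    have h3 := hY.2 u ⟨hu, by linarith⟩ v ⟨by linarith, by linarith⟩ huv
    have h4 := htime (v - u) (by linarith) (by linarith) (Y u)
    have h5 := hY.1 u ⟨hu, by linarith⟩
    calc _ ≤ C₂ * (t - v) ^ (-(γ + τ)) * (N * (v - u) ^ γ + C₃ * (v - u) ^ γ * N) := by
          gcongr
          exact (norm_sub_le _ _).trans (add_le_add h3 (h4.trans (by gcongr)))
      _ = (C₂ * (1 + C₃)) * N * (t - v) ^ (-(γ + τ)) * (v - u) ^ γ := by ring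
      _ ≤ _ := by
        gcongr
        linarith
  obtain ⟨J, hJ, hJle⟩ := hyoung w K ((C₁ + C₂ * (1 + C₃)) * N)
    (fun u => hE.smoothing p c (t - u) (Y u)) s t hw hK (by positivity) hs hst (ht.trans hT)
    hbound hincr
  exact ⟨J, hJ, hJle.trans_eq (by ring)⟩

/-- The Young convolution exists, and is a convolution with the semigroup in the sense of
`MildBound`. -/
theorem exists_young_convolution (hE : 𝓑.Generates E S) {p q a b c γ η τ κ : ℝ} (hqp : q ≤ p)
    (hγ : p - q = γ) (hγ1 : γ ≤ 1) (hab : a ≤ b) (hbc : b ≤ c) (hpb : p ≤ b) (hap : a ≤ p)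
    (hc : c - p ≤ τ) (hτ : 0 ≤ τ) (hτη : τ < η) (hγη : 1 < γ + η) 
    (hκτ : κ ≤ η - τ) (hκγ : γ + κ ≤ η) :
    ∃ C : ℝ, 0 ≤ C ∧ ∀ (w : ℝ≥0 → ℝ) (K N T : ℝ) (Y : ℝ → B p), DyadicHolder w η K →
      0 ≤ K → 0 ≤ N → T ≤ 1 → 𝓑.VBound hqp γ T N Y → ∃ Φ : ℝ → B b,
      (∀ t ∈ Icc 0 T, Tendsto (𝓑.youngSum S hpb w Y t) atTop (𝓝 (Φ t))) ∧
      𝓑.MildBound S hab hbc γ κ (C * K * N) T Φ := by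
  obtain ⟨C₁, hC₁, hest₁⟩ := hE.exists_young_estimate (c := c) hqp hγ hγ1 hc hτ hτη hγη
  obtain ⟨C₂, hC₂, hest₂⟩ := hE.exists_young_estimate (c := a) hqp hγ hγ1 (by linarith)
    le_rfl (hτ.trans_lt hτη) hγη
  refine ⟨C₁ + C₂, by positivity, ?_⟩
  intro w K N T Y hw hK hN hT hY
  have hlim : ∀ s t, 0 ≤ s → s ≤ t → t ≤ T → ∃ ψ : B c,
      Tendsto (dyadicSum w (fun u => hE.smoothing p b (t - u) (Y u)) s t) atTop
        (𝓝 (𝓑.emb hbc ψ)) ∧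
      ‖ψ‖ ≤ (C₁ + C₂) * K * N * (t - s) ^ κ ∧
      ‖𝓑.emb (hab.trans hbc) ψ‖ ≤ (C₁ + C₂) * K * N * (t - s) ^ (γ + κ) := by
    intro s t hs hst ht
    rcases hst.eq_or_lt with rfl | hst
    · refine ⟨0, ?_, ?_, ?_⟩
      · rw [map_zero]
        refine tendsto_const_nhds.congr fun k => ?_
        simp [dyadicSum]
      · rw [norm_zero, sub_self]
        positivity
      · rw [map_zero, norm_zero, sub_self]
        positivity
    · have hts0 : 0 < t - s := by linarith
      have hts1 : t - s ≤ 1 := by linarith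
      obtain ⟨ψ, h1, h2⟩ := hest₁ w K N T Y s t hw hK hN hT hY hs hst ht
      obtain ⟨ψ', h1', h2'⟩ := hest₂ w K N T Y s t hw hK hN hT hY hs hst ht
      have hmap : ∀ d (hd : d ≤ c), Tendsto (dyadicSum w (fun u => hE.smoothing p d (t - u) (Y u))
          s t) atTop (𝓝 (𝓑.emb hd ψ)) := by
        intro d hd
        refine (((𝓑.emb hd).continuous.tendsto ψ).comp h1).congr fun k => ?_
        rw [Function.comp_apply, map_dyadicSum]
        exact dyadicSum_congr w (fun u hu hut =>
          hE.emb_smoothing_eq (by linarith) (by linarith) hd (Y u)) k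
      refine ⟨ψ, hmap b hbc, h2.trans ?_, ?_⟩
      · calc C₁ * K * N * (t - s) ^ (η - τ) ≤ (C₁ + C₂) * K * N * (t - s) ^ (η - τ) := by
              gcongr
              linarith
          _ ≤ (C₁ + C₂) * K * N * (t - s) ^ κ :=
              mul_le_mul_of_nonneg_left (Real.rpow_le_rpow_of_exponent_ge hts0 hts1 hκτ)
                (by positivity)
      · rw [tendsto_nhds_unique (hmap a _) h1']
        calc _ ≤ C₂ * K * N * (t - s) ^ (η - 0) := h2'
          _ ≤ (C₁ + C₂) * K * N * (t - s) ^ (η - 0) := by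
              gcongr
              linarith
          _ ≤ (C₁ + C₂) * K * N * (t - s) ^ (γ + κ) :=
              mul_le_mul_of_nonneg_left
                (Real.rpow_le_rpow_of_exponent_ge hts0 hts1 (by linarith)) (by positivity)
  choose! ψ hψ hψ₁ hψ₂ using hlim
  have hΦ : ∀ t ∈ Icc 0 T, Tendsto (𝓑.youngSum S hpb w Y t) atTop (𝓝 (𝓑.emb hbc (ψ 0 t))) :=
    fun t ht => (hψ 0 t le_rfl ht.1 ht.2).congr fun k =>
      (hE.youngSum_eq_dyadicSum hpb w Y (ht.2.trans hT) k).symm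
  refine ⟨fun t => 𝓑.emb hbc (ψ 0 t), hΦ, fun s t hs hst ht =>
    ⟨ψ s t, ?_, hψ₁ s t hs hst ht, hψ₂ s t hs hst ht⟩⟩
  refine tendsto_nhds_unique (hψ 0 t le_rfl (hs.trans hst) ht) ?_
  have h1 := (((S b (t - s)).continuous.tendsto _).comp (hψ 0 s le_rfl hs (hst.trans ht))).add
    (hψ s t hs hst ht)
  refine h1.congr fun k => ?_
  rw [Function.comp_apply, map_dyadicSum, ← dyadicSum_zero_add w _ hst]
  congr 1
  refine dyadicSum_congr w (fun u hu hus => ?_) k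
  rw [hE.apply_smoothing (by linarith) (by linarith) (by linarith)]
  congr 2
  ring

end Generates

end InterpolationScale

namespace InterpolationScale

variable {B : ℝ → Type*} [∀ a, NormedAddCommGroup (B a)] [∀ a, NormedSpace ℝ (B a)]
  {𝓑 : InterpolationScale B} {E : ∀ a : ℝ, B (a + 1) →L[ℝ] B a} {S : ∀ a : ℝ, ℝ → B a →L[ℝ] B a}

namespace Generates

theorem continuousOn_smoothing (hE : 𝓑.Generates E S) (p c : ℝ) (x : B p) :
    ContinuousOn (fun t => hE.smoothing p c t x) (Ioc 0 1) := by
  intro t ht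
  obtain ⟨M, -, hM⟩ := (hE.analytic c).exists_norm_le
  have h1 := (hE.analytic c).toIsC0Semigroup.continuousOn hM (hE.smoothing p c (t / 2) x)
  have h2 : ContinuousOn (fun r => S c (r - t / 2) (hE.smoothing p c (t / 2) x))
      (Icc (t / 2) 1) := by
    refine h1.comp (by fun_prop) fun r hr => ⟨?_, ?_⟩
    · linarith [hr.1]
    · linarith [hr.2, ht.1]
  have h3 : ContinuousOn (fun r => hE.smoothing p c r x) (Icc (t / 2) 1) := by
    refine h2.congr fun r hr => ?_
    simp only
    rw [hE.apply_smoothing (by linarith [hr.1]) (by linarith [ht.1]) (by linarith [hr.2])]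
    congr 2
    ring
  refine (h3 t ⟨by linarith [ht.1], ht.2⟩).mono_of_mem_nhdsWithin ?_
  filter_upwards [self_mem_nhdsWithin, mem_nhdsWithin_of_mem_nhds (lt_mem_nhds (half_lt_self ht.1))]
    with r hr hr'
  exact ⟨hr'.le, hr.2⟩

theorem continuousOn_smoothing_comp (hE : 𝓑.Generates E S) {p c s t : ℝ} {G : ℝ → B p}
    (hs : 0 ≤ s) (ht : t ≤ 1) (hG : ContinuousOn G (Icc s t)) :
    ContinuousOn (fun r => hE.smoothing p c (t - r) (G r)) (Ioo s t) := by
  obtain ⟨C, hC, hU⟩ := hE.exists_norm_smoothing_le p c (le_max_left _ _) (le_max_right (c - p) 0)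
  set τ := max (c - p) 0
  intro r hr
  have h1 : ContinuousWithinAt (fun u => hE.smoothing p c (t - u) (G r)) (Ioo s t) r := by
    refine ((hE.continuousOn_smoothing p c (G r)).comp (f := fun u => t - u) (by fun_prop) ?_) r hr
    intro u hu
    exact ⟨by linarith [hu.2], by linarith [hu.1]⟩
  have h2 : Tendsto (fun u => hE.smoothing p c (t - u) (G u - G r)) (𝓝[Ioo s t] r) (𝓝 0) := by
    have hGr : Tendsto (fun u => C * (t - u) ^ (-τ) * ‖G u - G r‖) (𝓝[Ioo s t] r) (𝓝 0) := by
      have hG' : Tendsto G (𝓝[Ioo s t] r) (𝓝 (G r)) :=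
        (hG.mono Ioo_subset_Icc_self) r hr
      have h3 : ContinuousAt (fun u : ℝ => C * (t - u) ^ (-τ)) r := by
        have : t - r ≠ 0 := by linarith [hr.2]
        exact continuousAt_const.mul
          ((continuousAt_const.sub continuousAt_id).rpow_const (Or.inl this))
      have := (h3.tendsto.mono_left nhdsWithin_le_nhds).mul (hG'.sub_const (G r)).norm
      simpa using this
    refine squeeze_zero_norm' ?_ hGr
    filter_upwards [self_mem_nhdsWithin] with u hu
    exact hU _ (by linarith [hu.2]) (by linarith [hu.1]) _
  have h3 := h2.add h1.tendsto
  rw [zero_add] at h3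
  refine h3.congr fun u => ?_
  rw [← map_add, sub_add_cancel]

/-- The integral `∫_s^t S_{t-r} G_r dr` in `B_c`: the singularity `(t-r)^{-τ}` of the smoothing
estimate is integrable, and its integral has order `(t-s)^{1-τ}`. -/
theorem exists_drift_estimate (hE : 𝓑.Generates E S) {p c τ : ℝ} (hc : c - p ≤ τ) (hτ : 0 ≤ τ)
    (hτ1 : τ < 1) :
    ∃ C : ℝ, 0 ≤ C ∧ ∀ (N : ℝ) (G : ℝ → B p) (s t : ℝ), 0 ≤ s → s ≤ t → t ≤ 1 →
      ContinuousOn G (Icc s t) → (∀ r ∈ Icc s t, ‖G r‖ ≤ N) →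
      IntervalIntegrable (fun r => hE.smoothing p c (t - r) (G r)) volume s t ∧
      ‖∫ r in s..t, hE.smoothing p c (t - r) (G r)‖ ≤ C * N * (t - s) ^ (1 - τ) := by
  obtain ⟨C, hC, hU⟩ := hE.exists_norm_smoothing_le p c hc hτ
  refine ⟨C / (1 - τ), div_nonneg hC (by linarith), ?_⟩
  intro N G s t hs hst ht hG hGN
  have hint : IntervalIntegrable (fun r : ℝ => C * N * (t - r) ^ (-τ)) volume s t := by
    have h1 : IntervalIntegrable (fun r : ℝ => r ^ (-τ)) volume (t - s) (t - t) :=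
      intervalIntegral.intervalIntegrable_rpow' (by linarith)
    have h2 := (h1.comp_sub_left t).const_mul (C * N)
    simpa using h2
  have hle : ∀ r ∈ Ioo s t, ‖hE.smoothing p c (t - r) (G r)‖ ≤ C * N * (t - r) ^ (-τ) := by
    intro r hr
    refine (hU _ (by linarith [hr.2]) (by linarith [hr.1]) _).trans ?_
    have h1 := hGN r (Ioo_subset_Icc_self hr)
    have h2 : 0 ≤ (t - r) ^ (-τ) := Real.rpow_nonneg (by linarith [hr.2]) _
    calc C * (t - r) ^ (-τ) * ‖G r‖ ≤ C * (t - r) ^ (-τ) * N := by gcongr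
      _ = _ := by ring
  have hae : ∀ᵐ r ∂volume.restrict (Ioc s t),
      ‖hE.smoothing p c (t - r) (G r)‖ ≤ C * N * (t - r) ^ (-τ) := by
    rw [← restrict_Ioo_eq_restrict_Ioc]
    exact ae_restrict_of_forall_mem measurableSet_Ioo hle
  refine ⟨?_, ?_⟩
  · rw [intervalIntegrable_iff_integrableOn_Ioc_of_le hst] at hint ⊢
    refine Integrable.mono' hint ?_ hae
    rw [← restrict_Ioo_eq_restrict_Ioc]
    exact (hE.continuousOn_smoothing_comp hs ht hG).aestronglyMeasurable measurableSet_Ioo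
  · have hae' : ∀ᵐ r, r ∈ Ioc s t →
        ‖hE.smoothing p c (t - r) (G r)‖ ≤ C * N * (t - r) ^ (-τ) :=
      (ae_restrict_iff' measurableSet_Ioc).1 hae
    refine (intervalIntegral.norm_integral_le_of_norm_le hst hae' hint).trans_eq ?_
    rw [intervalIntegral.integral_const_mul,
      intervalIntegral.integral_comp_sub_left (fun r => r ^ (-τ)), sub_self,
      integral_rpow (Or.inl (by linarith)), show -τ + 1 = 1 - τ by ring,
      Real.zero_rpow (by linarith)]
    ring

variable [∀ a, CompleteSpace (B a)]

/-- The convolution of the semigroup with a continuous function. The two exponents `τ` and `τ'`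
bound the order of smoothing from `B_p` to `B_c` and to `B_a`. -/
theorem exists_drift_convolution (hE : 𝓑.Generates E S) {p a b c γ τ τ' κ : ℝ}
    (hab : a ≤ b) (hbc : b ≤ c) (hpb : p ≤ b)
    (hc : c - p ≤ τ) (hτ : 0 ≤ τ) (hτ1 : τ < 1) (ha : a - p ≤ τ') (hτ' : 0 ≤ τ') (hτ'1 : τ' < 1)
    (hκ : 0 ≤ κ) (hγ : 0 ≤ γ) (hκτ : κ ≤ 1 - τ) (hκγ : γ + κ ≤ 1 - τ') :
    ∃ C : ℝ, 0 ≤ C ∧ ∀ (N T : ℝ) (G : ℝ → B p), 0 ≤ N → T ≤ 1 →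
      ContinuousOn G (Icc 0 T) → (∀ r ∈ Icc 0 T, ‖G r‖ ≤ N) →
      (∀ t ∈ Icc 0 T, IntervalIntegrable (fun r => 𝓑.lift hpb (S p (t - r) (G r))) volume 0 t) ∧
      𝓑.MildBound S hab hbc γ κ (C * N) T
        (fun t => ∫ r in (0 : ℝ)..t, 𝓑.lift hpb (S p (t - r) (G r))) := by
  obtain ⟨C₁, hC₁, hest₁⟩ := hE.exists_drift_estimate hc hτ hτ1
  obtain ⟨C₂, hC₂, hest₂⟩ := hE.exists_drift_estimate ha hτ' hτ'1
  obtain ⟨C₃, hC₃, hest₃⟩ := hE.exists_drift_estimate (p := p) (c := b) (by linarith) hτ hτ1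
  refine ⟨C₁ + C₂, by positivity, ?_⟩
  intro N T G hN hT hG hGN
  have hlift : ∀ s t, 0 ≤ s → t ≤ T → EqOn (fun r => hE.smoothing p b (t - r) (G r))
      (fun r => 𝓑.lift hpb (S p (t - r) (G r))) (Ioo s t) := by
    intro s t hs ht r hr
    exact (hE.lift_apply (by linarith [hr.2]) (by linarith [hr.1]) hpb (G r)).symm
  have hsub : ∀ s t, 0 ≤ s → t ≤ T → Icc s t ⊆ Icc 0 T := fun s t hs ht =>
    Icc_subset_Icc hs ht
  refine ⟨fun t ht => ?_, ?_⟩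
  · refine (hest₃ N G 0 t le_rfl ht.1 (ht.2.trans hT) (hG.mono (hsub 0 t le_rfl ht.2))
      fun r hr => hGN r (hsub 0 t le_rfl ht.2 hr)).1.congr_uIoo ?_
    rw [uIoo_of_le ht.1]
    exact hlift 0 t le_rfl ht.2
  intro s t hs hst ht
  have hcont := hG.mono (hsub s t hs ht)
  have hbd := fun r hr => hGN r (hsub s t hs ht hr)
  obtain ⟨hi₁, hle₁⟩ := hest₁ N G s t hs hst (ht.trans hT) hcont hbd
  obtain ⟨-, hle₂⟩ := hest₂ N G s t hs hst (ht.trans hT) hcont hbd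
  have hts0 : 0 ≤ t - s := by linarith
  have hts1 : t - s ≤ 1 := by linarith
  have hemb : ∀ d (hd : d ≤ c), 𝓑.emb hd (∫ r in s..t, hE.smoothing p c (t - r) (G r)) =
      ∫ r in s..t, hE.smoothing p d (t - r) (G r) := by
    intro d hd
    rw [← ContinuousLinearMap.intervalIntegral_comp_comm _ hi₁]
    refine intervalIntegral.integral_congr_Ioo hst fun r hr => ?_
    exact hE.emb_smoothing_eq (by linarith [hr.2]) (by linarith [hr.1]) hd (G r)
  refine ⟨∫ r in s..t, hE.smoothing p c (t - r) (G r), ?_, ?_, ?_⟩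
  · have ht0 := hs.trans hst
    obtain ⟨hi, -⟩ := hest₃ N G 0 t le_rfl ht0 (ht.trans hT)
      (hG.mono (hsub 0 t le_rfl ht)) fun r hr => hGN r (hsub 0 t le_rfl ht hr)
    obtain ⟨hi', -⟩ := hest₃ N G 0 s le_rfl hs (by linarith)
      (hG.mono (hsub 0 s le_rfl (by linarith)))
      fun r hr => hGN r (hsub 0 s le_rfl (by linarith) hr)
    beta_reduce
    rw [hemb b hbc, ← intervalIntegral.integral_congr_Ioo ht0 (hlift 0 t le_rfl ht),
      ← intervalIntegral.integral_congr_Ioo hs (hlift 0 s le_rfl (by linarith)),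
      ← ContinuousLinearMap.intervalIntegral_comp_comm _ hi']
    have h1 : ∫ r in (0 : ℝ)..s, S b (t - s) (hE.smoothing p b (s - r) (G r)) =
        ∫ r in (0 : ℝ)..s, hE.smoothing p b (t - r) (G r) := by
      refine intervalIntegral.integral_congr_Ioo hs fun r hr => ?_
      rw [hE.apply_smoothing hts0 (by linarith [hr.2]) (by linarith [hr.1])]
      congr 2
      ring
    rw [h1, intervalIntegral.integral_add_adjacent_intervals]
    · exact hi.mono_set (by rw [uIcc_of_le hs, uIcc_of_le ht0]; exact Icc_subset_Icc_right hst)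
    · exact hi.mono_set (by rw [uIcc_of_le hst, uIcc_of_le ht0]; exact Icc_subset_Icc_left hs)
  · calc _ ≤ C₁ * N * (t - s) ^ (1 - τ) := hle₁
      _ ≤ (C₁ + C₂) * N * (t - s) ^ κ := by
        have := Real.rpow_le_rpow_of_exponent_ge' hts0 hts1 hκ hκτ
        gcongr
        linarith
  · rw [hemb a (hab.trans hbc)]
    calc _ ≤ C₂ * N * (t - s) ^ (1 - τ') := hle₂
      _ ≤ (C₁ + C₂) * N * (t - s) ^ (γ + κ) := by
        have := Real.rpow_le_rpow_of_exponent_ge' hts0 hts1 (by positivity) hκγ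
        gcongr
        linarith

end Generates

end InterpolationScale

/-! ### The nonlinearities on bounded sets of paths -/

section Nonlinearity

variable {X Y : Type*} [NormedAddCommGroup X] [NormedSpace ℝ X] [NormedAddCommGroup Y]
  [NormedSpace ℝ Y]

theorem IsTwiceDiffBounded.exists_norm_sub_le {f : X → Y} (hf : IsTwiceDiffBounded f) :
    ∃ C : ℝ, 0 ≤ C ∧ ∀ x y, ‖f x - f y‖ ≤ C * ‖x - y‖ := by
  obtain ⟨h1, -, C, hC⟩ := hf
  refine ⟨C, (norm_nonneg _).trans (hC 0).1, fun x y => ?_⟩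
  exact convex_univ.norm_image_sub_le_of_norm_fderiv_le (fun x _ => h1 x) (fun x _ => (hC x).1)
    (mem_univ y) (mem_univ x)

/-- The second order increment of a map with bounded first and second derivatives. -/
theorem IsTwiceDiffBounded.exists_norm_sub_sub_sub_le {f : X → Y} (hf : IsTwiceDiffBounded f) :
    ∃ C : ℝ, 0 ≤ C ∧ ∀ a b c d, ‖(f a - f b) - (f c - f d)‖ ≤
      C * ‖(a - b) - (c - d)‖ + C * ‖c - d‖ * ‖b - d‖ := by
  obtain ⟨h1, h2, C, hC⟩ := hf
  have hC0 : 0 ≤ C := (norm_nonneg _).trans (hC 0).1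
  have hlip : ∀ x y, ‖f x - f y‖ ≤ C * ‖x - y‖ := fun x y =>
    convex_univ.norm_image_sub_le_of_norm_fderiv_le (fun x _ => h1 x) (fun x _ => (hC x).1)
      (mem_univ y) (mem_univ x)
  have hlip' : ∀ x y, ‖fderiv ℝ f x - fderiv ℝ f y‖ ≤ C * ‖x - y‖ := fun x y =>
    convex_univ.norm_image_sub_le_of_norm_fderiv_le (fun x _ => h2 x) (fun x _ => (hC x).2)
      (mem_univ y) (mem_univ x)
  refine ⟨C, hC0, fun a b c d => ?_⟩
  -- the map `x ↦ f (x + h) - f x` has derivative of norm at most `C ‖h‖`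
  set h := c - d with hh
  have hg : ∀ x, HasFDerivAt (fun x => f (x + h) - f x) (fderiv ℝ f (x + h) - fderiv ℝ f x) x :=
    fun x => ((hasFDerivAt_comp_add_right h).2 (h1 (x + h)).hasFDerivAt).sub (h1 x).hasFDerivAt
  have h3 : ‖(f (b + h) - f b) - (f (d + h) - f d)‖ ≤ C * ‖h‖ * ‖b - d‖ :=
    convex_univ.norm_image_sub_le_of_norm_hasFDerivWithin_le
      (fun x _ => (hg x).hasFDerivWithinAt)
      (fun x _ => by simpa using hlip' (x + h) x) (mem_univ d) (mem_univ b)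
  have h4 := hlip a (b + h)
  have hd : d + h = c := by rw [hh]; abel
  have e1 : (f a - f b) - (f c - f d) =
      (f a - f (b + h)) + ((f (b + h) - f b) - (f (d + h) - f d)) := by
    rw [hd]
    abel
  have e2 : a - (b + h) = (a - b) - h := by abel
  rw [e1, ← e2]
  exact (norm_add_le _ _).trans (add_le_add h4 h3)

end Nonlinearity

namespace InterpolationScale

variable {B : ℝ → Type*} [∀ a, NormedAddCommGroup (B a)] [∀ a, NormedSpace ℝ (B a)]
  {𝓑 : InterpolationScale B} {E : ∀ a : ℝ, B (a + 1) →L[ℝ] B a} {S : ∀ a : ℝ, ℝ → B a →L[ℝ] B a}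

/-- The noise coefficient maps bounded sets of paths to bounded sets of paths, and is locally
Lipschitz there. -/
theorem exists_vBound_comp {a b p q γ : ℝ} (hab : a ≤ b) (hqp : q ≤ p) {F : B b → B p}
    {F' : B a → B q} (hFF' : ∀ x, 𝓑.emb hqp (F x) = F' (𝓑.emb hab x))
    (hF' : IsTwiceDiffBounded F') (hFgrowth : ∃ C : ℝ, ∀ x, ‖F x‖ ≤ C * ‖x‖)
    (hFlip : ∃ C : ℝ, ∀ x y, ‖F x - F y‖ ≤ C * ‖x - y‖) :
    ∃ C : ℝ, 0 ≤ C ∧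
      (∀ (T R : ℝ) (y : ℝ → B b), 0 ≤ R → 𝓑.VBound hab γ T R y → 𝓑.VBound hqp γ T (C * R) (fun t => F (y t))) ∧
      ∀ (T R N : ℝ) (y y' : ℝ → B b), 0 ≤ R → 0 ≤ N → 𝓑.VBound hab γ T R y' →
        𝓑.VBound hab γ T N (fun t => y t - y' t) →
        𝓑.VBound hqp γ T (C * (1 + R) * N) (fun t => F (y t) - F (y' t)) := by
  obtain ⟨C₁, hC₁⟩ := hFgrowth
  obtain ⟨C₂, hC₂⟩ := hFlip
  obtain ⟨C₃, hC₃0, hC₃⟩ := hF'.exists_norm_sub_le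
  obtain ⟨C₄, hC₄0, hC₄⟩ := hF'.exists_norm_sub_sub_sub_le
  obtain ⟨C₅, hC₅0, hC₅⟩ := 𝓑.exists_norm_emb_le hab
  refine ⟨|C₁| + |C₂| + C₃ + C₄ + C₄ * C₅, by positivity, ?_, ?_⟩
  · intro T R y hR hy
    refine ⟨fun t ht => ?_, fun s hs t ht hst => ?_⟩
    · calc ‖F (y t)‖ ≤ |C₁| * R := (hC₁ _).trans (by
            gcongr
            · exact le_abs_self _
            · exact hy.1 t ht)
        _ ≤ _ := by
          gcongr
          have : 0 ≤ |C₂| := abs_nonneg _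
          nlinarith [mul_nonneg hC₄0 hC₅0]
    · have h0 : 0 ≤ (t - s) ^ γ := Real.rpow_nonneg (by linarith) _
      have h1 := hy.2 s hs t ht hst
      rw [map_sub] at h1
      rw [map_sub, hFF', hFF']
      calc _ ≤ C₃ * (R * (t - s) ^ γ) := (hC₃ _ _).trans (by gcongr)
        _ ≤ (|C₁| + |C₂| + C₃ + C₄ + C₄ * C₅) * (R * (t - s) ^ γ) := by
          gcongr
          have := abs_nonneg C₂
          have := abs_nonneg C₁
          nlinarith [mul_nonneg hC₄0 hC₅0]
        _ = _ := by ring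
  · intro T R N y y' hR hN hy' hz
    have hc1 : |C₂| ≤ (|C₁| + |C₂| + C₃ + C₄ + C₄ * C₅) * (1 + R) := by
      have h1 : |C₂| ≤ |C₁| + |C₂| + C₃ + C₄ + C₄ * C₅ := by
        have := abs_nonneg C₁
        nlinarith [mul_nonneg hC₄0 hC₅0]
      nlinarith [abs_nonneg C₂]
    have hc2 : C₄ + C₄ * C₅ * R ≤ (|C₁| + |C₂| + C₃ + C₄ + C₄ * C₅) * (1 + R) := by
      have := abs_nonneg C₁
      have := abs_nonneg C₂
      have := mul_nonneg hC₄0 hC₅0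
      have : 0 ≤ (|C₁| + |C₂| + C₃ + C₄) * R := by positivity
      nlinarith
    refine ⟨fun t ht => ?_, fun s hs t ht hst => ?_⟩
    · calc ‖F (y t) - F (y' t)‖ ≤ |C₂| * N := (hC₂ _ _).trans (by
            gcongr
            · exact le_abs_self _
            · exact hz.1 t ht)
        _ ≤ _ := by gcongr
    · have h0 : 0 ≤ (t - s) ^ γ := Real.rpow_nonneg (by linarith) _
      have h1 := hy'.2 s hs t ht hst
      have h2 := hz.2 s hs t ht hst
      have h3 : ‖𝓑.emb hab (y s) - 𝓑.emb hab (y' s)‖ ≤ C₅ * N := by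
        rw [← map_sub]
        exact (hC₅ _).trans (by gcongr; exact hz.1 s hs)
      simp only [map_sub] at h1 h2
      simp only [map_sub, hFF']
      calc _ ≤ C₄ * (N * (t - s) ^ γ) + C₄ * (C₅ * N) * (R * (t - s) ^ γ) :=
            (hC₄ _ _ _ _).trans (by gcongr)
        _ = (C₄ + C₄ * C₅ * R) * N * (t - s) ^ γ := by ring
        _ ≤ _ := by gcongr

end InterpolationScale

theorem IsPolyLocallyLipschitz.exists_norm_sub_le {X Y : Type*} [NormedAddCommGroup X]
    [NormedAddCommGroup Y] {D : X → Y} (hD : IsPolyLocallyLipschitz D) {R : ℝ} (hR : 0 ≤ R) :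
    ∃ C : ℝ, 0 ≤ C ∧ (∀ x, ‖x‖ ≤ R → ‖D x‖ ≤ C) ∧
      ∀ x y, ‖x‖ ≤ R → ‖y‖ ≤ R → ‖D x - D y‖ ≤ C * ‖x - y‖ := by
  obtain ⟨C, p, q, hC, hp, hq, h1, h2⟩ := hD
  refine ⟨C * R ^ q + C * R ^ p, by positivity, fun x hx => ?_, fun x y hx hy => ?_⟩
  · calc ‖D x‖ ≤ C * R ^ q := (h1 x).trans (by gcongr)
      _ ≤ _ := le_add_of_nonneg_right (by positivity)
  · calc ‖D x - D y‖ ≤ C * R ^ p * ‖x - y‖ := (h2 x y).trans (by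
          gcongr
          exact max_le (by gcongr) (by gcongr))
      _ ≤ _ := by
        gcongr
        exact le_add_of_nonneg_left (by positivity)

theorem IsPolyLocallyLipschitz.continuous {X Y : Type*} [NormedAddCommGroup X]
    [NormedAddCommGroup Y] {D : X → Y} (hD : IsPolyLocallyLipschitz D) : Continuous D := by
  rw [continuous_iff_continuousAt]
  intro x
  obtain ⟨C, hC, -, hlip⟩ := hD.exists_norm_sub_le (R := ‖x‖ + 1) (by positivity)
  rw [ContinuousAt, tendsto_iff_norm_sub_tendsto_zero]
  have h1 : Tendsto (fun y => C * ‖y - x‖) (𝓝 x) (𝓝 0) :=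
    Continuous.tendsto' (by fun_prop) x 0 (by simp)
  refine squeeze_zero' (Eventually.of_forall fun y => norm_nonneg _) ?_ h1
  filter_upwards [Metric.ball_mem_nhds x one_pos] with y hy
  refine hlip y x ?_ (by linarith)
  rw [mem_ball_iff_norm] at hy
  calc ‖y‖ = ‖x + (y - x)‖ := by rw [add_sub_cancel]
    _ ≤ ‖x‖ + 1 := (norm_add_le _ _).trans (by linarith)

/-! ### The mild convolution -/

namespace InterpolationScale

variable {B : ℝ → Type*} [∀ a, NormedAddCommGroup (B a)] [∀ a, NormedSpace ℝ (B a)]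
  {𝓑 : InterpolationScale B} {E : ∀ a : ℝ, B (a + 1) →L[ℝ] B a} {S : ∀ a : ℝ, ℝ → B a →L[ℝ] B a}

/-- Both integrals of the mild formulation exist at the times in `[0,T]`, for the integrands `G`
(drift) and `Y` (noise). -/
def IsConvolvable (𝓑 : InterpolationScale B) (S : ∀ a : ℝ, ℝ → B a →L[ℝ] B a) {b d p : ℝ}
    (hdb : d ≤ b) (hpb : p ≤ b) (w : ℝ≥0 → ℝ) (T : ℝ) (G : ℝ → B d) (Y : ℝ → B p) : Prop :=
  ∀ t ∈ Icc 0 T,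
    IntervalIntegrable (fun r => 𝓑.lift hdb (S d (t - r) (G r))) volume 0 t ∧
    ∃ I : B b, Tendsto (𝓑.youngSum S hpb w Y t) atTop (𝓝 I)

/-- `-∫_0^t S_{t-r} G_r dr - ∫_0^t S_{t-r} Y_r dw_r`, with values in `B_b`. The value is
meaningful where both integrals exist, see `IsConvolvable`. -/
noncomputable def mildConvolution (𝓑 : InterpolationScale B) (S : ∀ a : ℝ, ℝ → B a →L[ℝ] B a)
    {b d p : ℝ} (hdb : d ≤ b) (hpb : p ≤ b) (w : ℝ≥0 → ℝ) (G : ℝ → B d) (Y : ℝ → B p)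
    (t : ℝ) : B b :=
  -(∫ r in (0 : ℝ)..t, 𝓑.lift hdb (S d (t - r) (G r))) -
    limUnder atTop (𝓑.youngSum S hpb w Y t)

namespace Generates

variable {b d p : ℝ} {hdb : d ≤ b} {hpb : p ≤ b} {w : ℝ≥0 → ℝ}

theorem mildConvolution_sub (hE : 𝓑.Generates E S) {T : ℝ} (hT : T ≤ 1) {G G' : ℝ → B d}
    {Y Y' : ℝ → B p} (h : 𝓑.IsConvolvable S hdb hpb w T G Y)
    (h' : 𝓑.IsConvolvable S hdb hpb w T G' Y') {t : ℝ} (ht : t ∈ Icc 0 T) :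
    𝓑.mildConvolution S hdb hpb w (fun r => G r - G' r) (fun r => Y r - Y' r) t =
      𝓑.mildConvolution S hdb hpb w G Y t - 𝓑.mildConvolution S hdb hpb w G' Y' t := by
  obtain ⟨hi, I, hI⟩ := h t ht
  obtain ⟨hi', I', hI'⟩ := h' t ht
  have ht1 : t ≤ 1 := ht.2.trans hT
  have hsum : Tendsto (𝓑.youngSum S hpb w (fun r => Y r - Y' r) t) atTop (𝓝 (I - I')) := by
    refine (hI.sub hI').congr fun k => ?_
    rw [hE.youngSum_eq_dyadicSum hpb w _ ht1, hE.youngSum_eq_dyadicSum hpb w _ ht1,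
      hE.youngSum_eq_dyadicSum hpb w _ ht1]
    simp [dyadicSum, smul_sub]
  have hint : ∫ r in (0 : ℝ)..t, 𝓑.lift hdb (S d (t - r) (G r - G' r)) =
      (∫ r in (0 : ℝ)..t, 𝓑.lift hdb (S d (t - r) (G r))) -
        ∫ r in (0 : ℝ)..t, 𝓑.lift hdb (S d (t - r) (G' r)) := by
    rw [← intervalIntegral.integral_sub hi hi']
    refine intervalIntegral.integral_congr_Ioo ht.1 fun r hr => ?_
    have h1 : 0 < t - r := by linarith [hr.2]
    have h2 : t - r ≤ 1 := by linarith [hr.1]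
    simp only [hE.lift_apply h1 h2]
    exact map_sub _ _ _
  unfold mildConvolution
  rw [hsum.limUnder_eq, hI.limUnder_eq, hI'.limUnder_eq, hint]
  abel

theorem mildConvolution_eq_zero (hE : 𝓑.Generates E S) {τ t : ℝ} (hτ : τ ≤ 1)
    {G : ℝ → B d} {Y : ℝ → B p} (hG : ∀ r ∈ Ico 0 τ, G r = 0) (hY : ∀ r ∈ Ico 0 τ, Y r = 0)
    (ht : t ∈ Icc 0 τ) : 𝓑.mildConvolution S hdb hpb w G Y t = 0 := by
  have hsum : Tendsto (𝓑.youngSum S hpb w Y t) atTop (𝓝 0) := by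
    refine tendsto_const_nhds.congr fun k => ?_
    rw [hE.youngSum_eq_dyadicSum hpb w _ (ht.2.trans hτ), dyadicSum_congr (g := fun _ => 0)]
    · simp [dyadicSum]
    · intro u hu hut
      rw [hY u ⟨hu, hut.trans_le ht.2⟩, map_zero]
  have hint : ∫ r in (0 : ℝ)..t, 𝓑.lift hdb (S d (t - r) (G r)) = 0 := by
    rw [← intervalIntegral.integral_zero (a := (0 : ℝ)) (b := t) (μ := volume) (E := B b)]
    refine intervalIntegral.integral_congr_Ioo ht.1 fun r hr => ?_
    have h1 : 0 < t - r := by linarith [hr.2]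
    have h2 : t - r ≤ 1 := by linarith [hr.1, ht.2]
    simp only [hE.lift_apply h1 h2]
    rw [hG r ⟨hr.1.le, hr.2.trans_le ht.2⟩, map_zero]
  unfold mildConvolution
  rw [hsum.limUnder_eq, hint]
  simp

variable [∀ a, CompleteSpace (B a)]

/-- The linear estimate behind the fixed point argument: on a time interval `[0,T]` such that the
integrands vanish before `τ`, the mild convolution gains the factor `(T-τ)^κ`. -/
theorem exists_mildConvolution_estimate (hE : 𝓑.Generates E S) {a q γ η K : ℝ} (hab : a ≤ b)
    (hqp : q ≤ p) (hbaγ : b - a = γ) (hpqγ : p - q = γ) (hγη : γ < η) (hη : η < 1)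
    (hγη1 : 1 < γ + η) (hd1 : b - d < 1) (hpγ : b - p < γ) (hK : 0 ≤ K)
    (hw : DyadicHolder w η K) :
    ∃ C κ : ℝ, 0 ≤ C ∧ 0 < κ ∧ ∀ (N T τ : ℝ) (G : ℝ → B d) (Y : ℝ → B p), 0 ≤ N → 0 ≤ τ →
      τ ≤ T → T ≤ 1 → ContinuousOn G (Icc 0 T) → (∀ r ∈ Icc 0 T, ‖G r‖ ≤ N) →
      𝓑.VBound hqp γ T N Y → (∀ r ∈ Ico 0 τ, G r = 0) → (∀ r ∈ Ico 0 τ, Y r = 0) →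
      𝓑.IsConvolvable S hdb hpb w T G Y ∧
      ContinuousOn (𝓑.mildConvolution S hdb hpb w G Y) (Icc 0 T) ∧
      𝓑.VBound hab γ T (C * N * (T - τ) ^ κ) (𝓑.mildConvolution S hdb hpb w G Y) := by
  have hγ0 : 0 < γ := by linarith
  set θ := b - p with hθ
  set β := b - d with hβ
  have hθ0 : 0 ≤ θ := by linarith
  have hβ0 : 0 ≤ β := by linarith
  -- the gain of regularity `ε` and the gain of a power of time `κ`
  set ε := min ((η - θ) / 2) ((1 - β) / 2) with hε
  have hε0 : 0 < ε := lt_min (by linarith) (by linarith)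
  have hε1 : ε ≤ (η - θ) / 2 := min_le_left _ _
  have hε2 : ε ≤ (1 - β) / 2 := min_le_right _ _
  set κ := min ε (min (η - γ) (1 - γ)) with hκ
  have hκ0 : 0 < κ := lt_min hε0 (lt_min (by linarith) (by linarith))
  have hκ1 : κ ≤ ε := min_le_left _ _
  have hκ2 : κ ≤ η - γ := (min_le_right _ _).trans (min_le_left _ _)
  have hκ3 : κ ≤ 1 - γ := (min_le_right _ _).trans (min_le_right _ _)
  have hbc : b < b + ε := by linarith
  obtain ⟨C₁, hC₁, h₁⟩ := hE.exists_young_convolution (c := b + ε) (τ := θ + ε) (η := η) (κ := κ)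
    hqp hpqγ (by linarith) hab hbc.le hpb (by linarith) (by linarith) (by linarith) (by linarith)
    hγη1 (by linarith) (by linarith)
  obtain ⟨C₂, hC₂, h₂⟩ := hE.exists_drift_convolution (c := b + ε) (τ := β + ε)
    (τ' := max (β - γ) 0) (γ := γ) (κ := κ) hab hbc.le hdb (by linarith) (by linarith)
    (by linarith) (le_max_of_le_left (by linarith)) (le_max_right _ _)
    (max_lt (by linarith) one_pos) hκ0.le hγ0.le (by linarith) (by
      have : max (β - γ) 0 ≤ 1 - γ - κ := max_le (by linarith) (by linarith)
      linarith)
  obtain ⟨C₃, hC₃, h₃⟩ := hE.exists_vBound_of_mildBound (κ := κ) hab hbc hbaγ (by linarith)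
    (by linarith) hκ0
  refine ⟨C₃ * (C₂ + C₁ * K), κ, by positivity, hκ0, ?_⟩
  intro N T τ G Y hN hτ hτT hT hG hGN hY hG0 hY0
  obtain ⟨Φ, hΦ, hΦm⟩ := h₁ w K N T Y hw hK hN hT hY
  obtain ⟨hint, hΨm⟩ := h₂ N T G hN hT hG hGN
  have hconv : EqOn (fun t => -(∫ r in (0 : ℝ)..t, 𝓑.lift hdb (S d (t - r) (G r))) + -Φ t)
      (𝓑.mildConvolution S hdb hpb w G Y) (Icc 0 T) := by
    intro t ht
    simp only [mildConvolution, (hΦ t ht).limUnder_eq, sub_eq_add_neg]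
  have hzero : ∀ t ∈ Icc 0 τ,
      -(∫ r in (0 : ℝ)..t, 𝓑.lift hdb (S d (t - r) (G r))) + -Φ t = 0 := by
    intro t ht
    rw [← hE.mildConvolution_eq_zero (hdb := hdb) (hpb := hpb) (w := w) (hτT.trans hT) hG0 hY0 ht]
    exact hconv ⟨ht.1, ht.2.trans hτT⟩
  obtain ⟨hcont, hV⟩ := h₃ (C₂ * N + C₁ * K * N) T τ _ (by positivity) hT hτ hτT
    (hΨm.neg.add hΦm.neg) hzero
  refine ⟨fun t ht => ⟨hint t ht, Φ t, hΦ t ht⟩, hcont.congr hconv.symm, ?_⟩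
  have e : C₃ * (C₂ * N + C₁ * K * N) = C₃ * (C₂ + C₁ * K) * N := by ring
  rw [e] at hV
  exact hV.congr hconv

end Generates

/-! ### Picard iteration -/

/-- Paths of `C([0,T]; B_b) ∩ C^γ([0,T]; B_a)` of norm at most `R`. -/
def VBall (𝓑 : InterpolationScale B) {a b : ℝ} (h : a ≤ b) (γ T R : ℝ) (y : ℝ → B b) : Prop :=
  ContinuousOn y (Icc 0 T) ∧ 𝓑.VBound h γ T R y

theorem VBall.vBound_sub {a b : ℝ} {h : a ≤ b} {γ T R R' : ℝ} {y y' : ℝ → B b}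
    (hy : 𝓑.VBall h γ T R y) (hy' : 𝓑.VBall h γ T R' y') :
    𝓑.VBound h γ T (R + R') (fun t => y t - y' t) := by
  simpa only [sub_eq_add_neg] using hy.2.add hy'.2.neg

theorem VBound.nonneg {a b : ℝ} {h : a ≤ b} {γ T N : ℝ} {y : ℝ → B b}
    (hy : 𝓑.VBound h γ T N y) (hT : 0 ≤ T) : 0 ≤ N :=
  (norm_nonneg _).trans (hy.1 0 ⟨le_rfl, hT⟩)

theorem VBound.of_tendsto {a b : ℝ} {h : a ≤ b} {γ T N : ℝ} {u : ℕ → ℝ → B b} {y : ℝ → B b}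
    (hu : ∀ᶠ n in atTop, 𝓑.VBound h γ T N (u n))
    (hlim : ∀ t ∈ Icc 0 T, Tendsto (fun n => u n t) atTop (𝓝 (y t))) :
    𝓑.VBound h γ T N y := by
  refine ⟨fun t ht => ?_, fun s hs t ht hst => ?_⟩
  · exact le_of_tendsto (hlim t ht).norm (hu.mono fun n hn => hn.1 t ht)
  · have h1 := (((𝓑.emb h).continuous.tendsto _).comp ((hlim t ht).sub (hlim s hs))).norm
    exact le_of_tendsto h1 (hu.mono fun n hn => hn.2 s hs t ht hst)

/-- A path whose norm is at most half of each of its bounds vanishes. -/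
theorem VBound.eq_zero {a b : ℝ} {h : a ≤ b} {γ T N : ℝ} {y : ℝ → B b}
    (hy : 𝓑.VBound h γ T N y)
    (hstep : ∀ N, 𝓑.VBound h γ T N y → 𝓑.VBound h γ T (N / 2) y) :
    ∀ t ∈ Icc 0 T, y t = 0 := by
  have h1 : ∀ n : ℕ, 𝓑.VBound h γ T (N * (1 / 2) ^ n) y := by
    intro n
    induction n with
    | zero => simpa using hy
    | succ n ih =>
      have := hstep _ ih
      rwa [show N * (1 / 2) ^ n / 2 = N * (1 / 2) ^ (n + 1) by ring] at this
  have h2 : Tendsto (fun n : ℕ => N * (1 / 2 : ℝ) ^ n) atTop (𝓝 0) := by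
    simpa using (tendsto_pow_atTop_nhds_zero_of_lt_one (r := (1 / 2 : ℝ)) (by norm_num)
      (by norm_num)).const_mul N
  intro t ht
  have h3 := ge_of_tendsto' h2 fun n => (h1 n).1 t ht
  simpa using h3

/-- The contraction principle in a ball of `C([0,T]; B_b) ∩ C^γ([0,T]; B_a)`. -/
theorem exists_fixedPoint [∀ a, CompleteSpace (B a)] {a b : ℝ} {h : a ≤ b} {γ T R : ℝ} (hT : 0 ≤ T)
    (M : (ℝ → B b) → ℝ → B b) (y₀ : ℝ → B b) (hy₀ : 𝓑.VBall h γ T R y₀)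
    (hself : ∀ y, 𝓑.VBall h γ T R y → 𝓑.VBall h γ T R (M y))
    (hcontr : ∀ N y y', 𝓑.VBall h γ T R y → 𝓑.VBall h γ T R y' →
      𝓑.VBound h γ T N (fun t => y t - y' t) →
      𝓑.VBound h γ T (N / 2) (fun t => M y t - M y' t)) :
    ∃ y, 𝓑.VBall h γ T R y ∧ EqOn (M y) y (Icc 0 T) := by
  set u : ℕ → ℝ → B b := fun n => M^[n] y₀ with hu
  have hsucc : ∀ n, u (n + 1) = M (u n) := fun n => Function.iterate_succ_apply' M n y₀
  have hball : ∀ n, 𝓑.VBall h γ T R (u n) := by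
    intro n
    induction n with
    | zero => exact hy₀
    | succ n ih => rw [hsucc]; exact hself _ ih
  have hR : 0 ≤ R := hy₀.2.nonneg hT
  have hdiff : ∀ n m, 𝓑.VBound h γ T (2 * R * (1 / 2) ^ n) (fun t => u n t - u (n + m) t) := by
    intro n
    induction n with
    | zero =>
      intro m
      have := (hball 0).vBound_sub (hball (0 + m))
      rwa [show 2 * R * (1 / 2) ^ 0 = R + R by ring]
    | succ n ih =>
      intro m
      have h1 := hcontr _ _ _ (hball n) (hball (n + m)) (ih m)
      rw [← hsucc, ← hsucc] at h1
      rwa [show n + 1 + m = n + m + 1 by ring,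
        show 2 * R * (1 / 2) ^ (n + 1) = 2 * R * (1 / 2) ^ n / 2 by ring]
  have hsmall : Tendsto (fun n : ℕ => 2 * R * (1 / 2 : ℝ) ^ n) atTop (𝓝 0) := by
    simpa using (tendsto_pow_atTop_nhds_zero_of_lt_one (r := (1 / 2 : ℝ)) (by norm_num)
      (by norm_num)).const_mul (2 * R)
  have hlim : ∀ t, ∃ z, t ∈ Icc 0 T → Tendsto (fun n => u n t) atTop (𝓝 z) := by
    intro t
    by_cases ht : t ∈ Icc 0 T
    · have : CauchySeq fun n => u n t := by
        refine cauchySeq_of_le_tendsto_0' _ (fun n m hnm => ?_) hsmall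
        obtain ⟨j, rfl⟩ := Nat.exists_eq_add_of_le hnm
        rw [dist_eq_norm]
        exact (hdiff n j).1 t ht
      obtain ⟨z, hz⟩ := cauchySeq_tendsto_of_complete this
      exact ⟨z, fun _ => hz⟩
    · exact ⟨0, fun h => (ht h).elim⟩
  choose y hy using hlim
  have hy1 : ∀ n, 𝓑.VBound h γ T (2 * R * (1 / 2) ^ n) (fun t => u n t - y t) := by
    intro n
    refine VBound.of_tendsto (Eventually.of_forall (hdiff n)) fun t ht => ?_
    refine tendsto_const_nhds.sub ?_
    exact (tendsto_add_atTop_iff_nat n).2 (hy t ht) |>.congr fun m => by rw [add_comm]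
  have hyball : 𝓑.VBall h γ T R y := by
    refine ⟨?_, VBound.of_tendsto (Eventually.of_forall fun n => (hball n).2) hy⟩
    have hunif : TendstoUniformlyOn u y atTop (Icc 0 T) := by
      rw [Metric.tendstoUniformlyOn_iff]
      intro ε hε
      filter_upwards [hsmall.eventually_lt_const hε] with n hn t ht
      rw [dist_comm, dist_eq_norm]
      exact ((hy1 n).1 t ht).trans_lt hn
    exact hunif.continuousOn (Frequently.of_forall fun n => (hball n).1)
  refine ⟨y, hyball, fun t ht => ?_⟩
  refine tendsto_nhds_unique (f := fun n => u (n + 1) t) (l := atTop) ?_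
    ((tendsto_add_atTop_iff_nat 1).2 (hy t ht))
  rw [tendsto_iff_norm_sub_tendsto_zero]
  refine squeeze_zero (fun n => norm_nonneg _) (fun n => ?_)
    (show Tendsto (fun n : ℕ => 2 * R * (1 / 2 : ℝ) ^ n / 2) atTop (𝓝 0) by
      simpa only [zero_div] using hsmall.div_const 2)
  rw [hsucc]
  exact (hcontr _ _ _ (hball n) hyball (hy1 n)).1 t ht

/-- Uniqueness of fixed points that are locally contracted: two fixed points that agree up to time
`τ` agree up to time `τ + δ`, and `δ` does not depend on `τ`. -/
theorem eqOn_of_fixedPoint {a b : ℝ} {h : a ≤ b} {γ T R δ : ℝ} (hδ : 0 < δ)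
    (M : (ℝ → B b) → ℝ → B b) {y y' : ℝ → B b} (hy : 𝓑.VBall h γ T R y)
    (hy' : 𝓑.VBall h γ T R y') (hfix : EqOn (M y) y (Icc 0 T)) (hfix' : EqOn (M y') y' (Icc 0 T))
    (hcontr : ∀ N T' τ, 0 ≤ τ → τ ≤ T' → T' ≤ T → T' - τ ≤ δ → EqOn y y' (Ico 0 τ) →
      𝓑.VBound h γ T' N (fun t => y t - y' t) →
      𝓑.VBound h γ T' (N / 2) (fun t => M y t - M y' t)) : EqOn y y' (Icc 0 T) := by
  have key : ∀ n : ℕ, ∀ t ∈ Icc 0 T, t ≤ n * δ → y t = y' t := by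
    intro n
    induction n with
    | zero =>
      intro t ht htn
      have ht0 : t = 0 := le_antisymm (by simpa using htn) ht.1
      subst ht0
      have h1 : 𝓑.VBound h γ 0 (R + R) (fun t => y t - y' t) :=
        (hy.vBound_sub hy').mono ht.2 le_rfl
      refine sub_eq_zero.1 (h1.eq_zero (fun N hN => ?_) 0 ⟨le_rfl, le_rfl⟩)
      refine (hcontr N 0 0 le_rfl le_rfl ht.2 (by linarith) (by simp) hN).congr ?_
      intro s hs
      have hs' : s ∈ Icc 0 T := ⟨hs.1, hs.2.trans ht.2⟩
      simp only [hfix hs', hfix' hs']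
    | succ n ih =>
      intro t ht htn
      rcases le_total t (n * δ) with htn' | htn'
      · exact ih t ht htn'
      have hτ : 0 ≤ n * δ := by positivity
      have h1 : 𝓑.VBound h γ t (R + R) (fun t => y t - y' t) :=
        (hy.vBound_sub hy').mono ht.2 le_rfl
      refine sub_eq_zero.1 (h1.eq_zero (fun N hN => ?_) t ⟨ht.1, le_rfl⟩)
      push_cast at htn
      refine (hcontr N t (n * δ) hτ htn' ht.2 (by linarith) ?_ hN).congr ?_
      · intro s hs
        exact ih s ⟨hs.1, by linarith [hs.2, ht.2]⟩ hs.2.le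
      · intro s hs
        have hs' : s ∈ Icc 0 T := ⟨hs.1, hs.2.trans ht.2⟩
        simp only [hfix hs', hfix' hs']
  intro t ht
  obtain ⟨n, hn⟩ := exists_nat_ge (t / δ)
  exact key n t ht ((div_le_iff₀ hδ).1 hn)

end InterpolationScale

/-! ### Dyadic increments of fractional Brownian motion -/

namespace IsFractionalBrownianMotion

variable {Ω : Type*} [MeasurableSpace Ω] {P : Measure Ω} [IsProbabilityMeasure P] {H : ℝ}
  {W : ℝ≥0 → Ω → ℝ}

theorem map_sub_eq (hW : IsFractionalBrownianMotion H W P) (hH : 0 < H) (s t : ℝ≥0) :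
    P.map (W t - W s) = gaussianReal 0 (|(t : ℝ) - s| ^ (2 * H)).toNNReal := by
  have hs := (hW.gaussian.hasGaussianLaw_eval s).memLp_two
  have ht := (hW.gaussian.hasGaussianLaw_eval t).memLp_two
  have hmean : P[W t - W s] = 0 := by
    rw [integral_sub' (ht.integrable (by norm_num)) (hs.integrable (by norm_num)),
      hW.centered, hW.centered, sub_zero]
  have hcov : ∀ r : ℝ≥0, Var[W r; P] = (r : ℝ) ^ (2 * H) := by
    intro r
    rw [← covariance_self (hW.gaussian.aemeasurable r), hW.covariance]
    simp [Real.zero_rpow (show 2 * H ≠ 0 by positivity)]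
  have hvar : Var[W t - W s; P] = |(t : ℝ) - s| ^ (2 * H) := by
    rw [variance_sub ht hs, hcov, hcov, hW.covariance, abs_sub_comm]
    ring
  rw [(hW.gaussian.hasGaussianLaw_sub (s := t) (t := s)).map_eq_gaussianReal, hmean, hvar]

/-- The Gaussian tail bound for an increment. -/
theorem measure_lt_abs_le (hW : IsFractionalBrownianMotion H W P) (hH : 0 < H) (s t : ℝ≥0) {ε : ℝ}
    (hε : 0 ≤ ε) :
    P {o | ε < |W t o - W s o|} ≤
      ENNReal.ofReal (2 * Real.exp (-ε ^ 2 / (2 * |(t : ℝ) - s| ^ (2 * H)))) := by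
  set v := (|(t : ℝ) - s| ^ (2 * H)).toNNReal with hv
  have hmap := hW.map_sub_eq hH s t
  have hvr : (v : ℝ) = |(t : ℝ) - s| ^ (2 * H) := Real.coe_toNNReal _ (by positivity)
  have hmeas : AEMeasurable (W t - W s) P :=
    (hW.gaussian.aemeasurable t).sub (hW.gaussian.aemeasurable s)
  have hsub : HasSubgaussianMGF (W t - W s) v P := by
    refine ⟨fun r => ?_, fun r => ?_⟩
    · have h1 := integrable_exp_mul_gaussianReal (μ := 0) (v := v) r
      rw [← hmap] at h1
      exact h1.comp_aemeasurable hmeas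
    · rw [mgf_gaussianReal (v := v) hmap, zero_mul, zero_add]
  have h1 := hsub.measure_ge_le hε
  have h2 := hsub.neg.measure_ge_le hε
  rw [hvr] at h1 h2
  calc P {o | ε < |W t o - W s o|}
      ≤ P ({o | ε ≤ (W t - W s) o} ∪ {o | ε ≤ (-(W t - W s)) o}) := by
        refine measure_mono fun o ho => ?_
        have ho' : ε < |W t o - W s o| := ho
        rcases lt_abs.1 ho' with h | h
        · exact Or.inl h.le
        · exact Or.inr h.le
    _ ≤ P {o | ε ≤ (W t - W s) o} + P {o | ε ≤ (-(W t - W s)) o} := measure_union_le _ _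
    _ ≤ _ := by
      rw [← ofReal_measureReal, ← ofReal_measureReal,
        ← ENNReal.ofReal_add measureReal_nonneg measureReal_nonneg]
      apply ENNReal.ofReal_le_ofReal
      linarith

/-- Borel-Cantelli: almost surely only finitely many dyadic increments exceed the Hölder bound
with exponent `η < H`. -/
theorem ae_exists_dyadicHolder (hW : IsFractionalBrownianMotion H W P) (hH : 0 < H) {η : ℝ}
    (hη : η < H) : ∀ᵐ o ∂P, ∃ K : ℝ, 0 ≤ K ∧ DyadicHolder (fun t => W t o) η K := by
  set A : ℕ → Set Ω := fun k =>
    ⋃ n ∈ Finset.range (2 ^ k), {o | ((2 ^ k : ℝ)⁻¹) ^ η < |dyadicIncrement (fun t => W t o) k n|}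
    with hA
  obtain ⟨m, hm⟩ := exists_nat_ge (1 / (H - η))
  have hm' : 1 ≤ m * (H - η) := by rwa [div_le_iff₀ (by linarith)] at hm
  -- `exp (-x / 2) ≤ m! 2^m x^{-m}` with `x = 2^{2k(H-η)}`
  have hexp : ∀ k : ℕ, Real.exp (-(((2 ^ k : ℝ)⁻¹) ^ η) ^ 2 / (2 * ((2 ^ k : ℝ)⁻¹) ^ (2 * H))) ≤
      (m.factorial * 2 ^ m) * ((2 ^ k : ℝ)⁻¹) ^ 2 := by
    intro k
    set h : ℝ := (2 ^ k : ℝ)⁻¹ with hh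
    have hh0 : 0 < h := by positivity
    have hh1 : h ≤ 1 := inv_le_one_of_one_le₀ (one_le_pow₀ (by norm_num))
    have e1 : -(h ^ η) ^ 2 / (2 * h ^ (2 * H)) = -(h ^ (-(2 * (H - η))) / 2) := by
      rw [show -(2 * (H - η)) = η * (2 : ℕ) - 2 * H by push_cast; ring, Real.rpow_sub hh0,
        Real.rpow_mul_natCast hh0.le]
      field_simp
    rw [e1, Real.exp_neg]
    have hx : 0 < h ^ (-(2 * (H - η))) / 2 := by positivity
    have h1 := Real.pow_div_factorial_le_exp _ hx.le m
    have h2 : (h ^ (-(2 * (H - η))) / 2) ^ m / m.factorial =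
        ((m.factorial * 2 ^ m) * h ^ (2 * (m * (H - η))))⁻¹ := by
      rw [div_pow, ← Real.rpow_mul_natCast hh0.le,
        show -(2 * (H - η)) * (m : ℕ) = -(2 * (m * (H - η))) by ring, Real.rpow_neg hh0.le]
      field_simp
    rw [h2] at h1
    refine (inv_le_of_inv_le₀ (by positivity) h1).trans ?_
    gcongr
    rw [← Real.rpow_natCast]
    exact Real.rpow_le_rpow_of_exponent_ge hh0 hh1 (by push_cast; linarith)
  have hPA : ∀ k, P (A k) ≤ ENNReal.ofReal (2 * (m.factorial * 2 ^ m) * (1 / 2) ^ k) := by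
    intro k
    have hsingle : ∀ n ∈ Finset.range (2 ^ k),
        P {o | ((2 ^ k : ℝ)⁻¹) ^ η < |dyadicIncrement (fun t => W t o) k n|} ≤
          ENNReal.ofReal (2 * ((m.factorial * 2 ^ m) * ((2 ^ k : ℝ)⁻¹) ^ 2)) := by
      intro n _
      have h1 := hW.measure_lt_abs_le hH (n / 2 ^ k) ((n + 1) / 2 ^ k)
        (ε := ((2 ^ k : ℝ)⁻¹) ^ η) (by positivity)
      have h2 : |((((n + 1) / 2 ^ k : ℝ≥0) : ℝ)) - ((n / 2 ^ k : ℝ≥0) : ℝ)| = (2 ^ k : ℝ)⁻¹ := by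
        push_cast
        rw [← sub_div, add_sub_cancel_left, one_div, abs_of_nonneg (by positivity)]
      rw [h2] at h1
      refine h1.trans (ENNReal.ofReal_le_ofReal ?_)
      gcongr
      exact hexp k
    calc P (A k) ≤ ∑ n ∈ Finset.range (2 ^ k),
          P {o | ((2 ^ k : ℝ)⁻¹) ^ η < |dyadicIncrement (fun t => W t o) k n|} :=
          measure_biUnion_finset_le _ _
      _ ≤ ∑ n ∈ Finset.range (2 ^ k),
          ENNReal.ofReal (2 * ((m.factorial * 2 ^ m) * ((2 ^ k : ℝ)⁻¹) ^ 2)) :=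
          Finset.sum_le_sum hsingle
      _ = _ := by
        rw [Finset.sum_const, Finset.card_range, nsmul_eq_mul,
          ← ENNReal.ofReal_natCast, ← ENNReal.ofReal_mul (by positivity)]
        congr 1
        have h2 : ((1 : ℝ) / 2) ^ k = (2 ^ k)⁻¹ := by rw [one_div, inv_pow]
        rw [h2]
        push_cast
        field_simp
  have hsum : ∑' k, P (A k) ≠ ⊤ := by
    refine ne_top_of_le_ne_top ?_ (ENNReal.tsum_le_tsum hPA)
    refine (Summable.tsum_ofReal_ne_top ?_)
    exact (summable_geometric_of_lt_one (by norm_num) (by norm_num)).mul_left _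
  filter_upwards [ae_eventually_notMem hsum] with o ho
  obtain ⟨k₀, hk₀⟩ := eventually_atTop.1 ho
  set f : ℕ → ℕ → ℝ := fun k n =>
    |dyadicIncrement (fun t => W t o) k n| / ((2 ^ k : ℝ)⁻¹) ^ η with hf
  have hf0 : ∀ k n, 0 ≤ f k n := fun k n => by positivity
  refine ⟨1 + ∑ k ∈ Finset.range k₀, ∑ n ∈ Finset.range (2 ^ k), f k n, ?_, fun k n hn => ?_⟩
  · have := Finset.sum_nonneg (s := Finset.range k₀) fun k _ =>
      Finset.sum_nonneg (s := Finset.range (2 ^ k)) fun n _ => hf0 k n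
    linarith
  have hpos : 0 < ((2 ^ k : ℝ)⁻¹) ^ η := by positivity
  rcases le_or_gt k₀ k with hk | hk
  · have h1 := hk₀ k hk
    simp only [hA, mem_iUnion, Finset.mem_range, mem_ofPred_eq, not_exists, not_lt] at h1
    refine (h1 n hn).trans (le_mul_of_one_le_left hpos.le ?_)
    have := Finset.sum_nonneg (s := Finset.range k₀) fun k _ =>
      Finset.sum_nonneg (s := Finset.range (2 ^ k)) fun n _ => hf0 k n
    linarith
  · rw [← div_le_iff₀ hpos]
    have h1 : f k n ≤ ∑ n ∈ Finset.range (2 ^ k), f k n :=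
      Finset.single_le_sum (f := fun n => f k n) (fun n _ => hf0 k n) (Finset.mem_range.2 hn)
    have h2 : ∑ n ∈ Finset.range (2 ^ k), f k n ≤
        ∑ k ∈ Finset.range k₀, ∑ n ∈ Finset.range (2 ^ k), f k n :=
      Finset.single_le_sum (f := fun k => ∑ n ∈ Finset.range (2 ^ k), f k n)
        (fun k _ => Finset.sum_nonneg fun n _ => hf0 k n) (Finset.mem_range.2 hk)
    change f k n ≤ _
    linarith

end IsFractionalBrownianMotion

/-! ### Local existence and uniqueness for a fixed path -/

theorem exists_mul_rpow_le_half {L κ : ℝ} (hL : 0 ≤ L) (hκ : 0 < κ) :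
    ∃ δ : ℝ, 0 < δ ∧ δ ≤ 1 ∧ ∀ r, 0 ≤ r → r ≤ δ → L * r ^ κ ≤ 1 / 2 := by
  have h1 : Tendsto (fun r : ℝ => L * r ^ κ) (𝓝[>] 0) (𝓝 0) := by
    have h2 : Continuous fun r : ℝ => L * r ^ κ :=
      continuous_const.mul (Real.continuous_rpow_const hκ.le)
    exact (h2.tendsto' 0 0 (by simp [Real.zero_rpow hκ.ne'])).mono_left nhdsWithin_le_nhds
  have h2 : ∀ᶠ δ : ℝ in 𝓝[>] 0, δ ≤ 1 := by
    filter_upwards [Ioc_mem_nhdsGT (zero_lt_one' ℝ)] with δ hδ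
    exact hδ.2
  obtain ⟨δ, hδ1, hδ2, hδ3⟩ :=
    ((h1.eventually_le_const (show (0 : ℝ) < 1 / 2 by norm_num)).and
      (h2.and self_mem_nhdsWithin)).exists
  refine ⟨δ, hδ3, hδ2, fun r hr hrδ => le_trans ?_ hδ1⟩
  gcongr

namespace InterpolationScale

variable {B : ℝ → Type*} [∀ a, NormedAddCommGroup (B a)] [∀ a, NormedSpace ℝ (B a)]
  {𝓑 : InterpolationScale B} {E : ∀ a : ℝ, B (a + 1) →L[ℝ] B a} {S : ∀ a : ℝ, ℝ → B a →L[ℝ] B a}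

theorem MemV.exists_vBall {a b : ℝ} {h : a ≤ b} {γ T : ℝ} {y : ℝ → B b} (hy : 𝓑.MemV h γ T y) :
    ∃ R, 0 ≤ R ∧ 𝓑.VBall h γ T R y := by
  obtain ⟨hc, K, hK⟩ := hy
  obtain ⟨C, hC⟩ := isCompact_Icc.exists_bound_of_continuousOn hc
  refine ⟨max (max C K) 0, le_max_right _ _, hc, fun t ht => ?_, fun s hs t ht hst => ?_⟩
  · exact (hC t ht).trans ((le_max_left _ _).trans (le_max_left _ _))
  · refine (hK s hs t ht).trans ?_
    rw [abs_of_nonneg (by linarith)]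
    exact mul_le_mul_of_nonneg_right ((le_max_right _ _).trans (le_max_left _ _))
      (Real.rpow_nonneg (by linarith) _)

theorem VBall.memV {a b : ℝ} {h : a ≤ b} {γ T R : ℝ} {y : ℝ → B b} (hy : 𝓑.VBall h γ T R y) :
    𝓑.MemV h γ T y := by
  refine ⟨hy.1, R, fun s hs t ht => ?_⟩
  rcases le_total s t with hst | hst
  · rw [abs_of_nonneg (by linarith)]
    exact hy.2.2 s hs t ht hst
  · rw [abs_sub_comm, abs_of_nonneg (by linarith), ← neg_sub, map_neg, norm_neg]
    exact hy.2.2 t ht s hs hst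

namespace Generates

/-- The orbit of a point of `B_b` lies in `C([0,T]; B_b) ∩ C^γ([0,T]; B_a)`, `γ = b - a`. -/
theorem exists_vBall_orbit (hE : 𝓑.Generates E S) {a b γ : ℝ} (hab : a ≤ b) (hγ : b - a = γ)
    (hγ1 : γ ≤ 1) (x : B b) :
    ∃ R, 0 ≤ R ∧ ∀ T ≤ 1, 𝓑.VBall hab γ T R (fun t => S b t x) := by
  obtain ⟨M, hM1, hM⟩ := (hE.analytic b).exists_norm_le
  obtain ⟨M', hM1', hM'⟩ := (hE.analytic a).exists_norm_le
  obtain ⟨C, hC, htime⟩ := hE.exists_norm_sub_le hab (by linarith)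
  rw [hγ] at htime
  refine ⟨M * ‖x‖ + M' * C * ‖x‖, by positivity, fun T hT => ⟨?_, fun t ht => ?_,
    fun s hs t ht hst => ?_⟩⟩
  · exact ((hE.analytic b).toIsC0Semigroup.continuousOn hM x).mono (Icc_subset_Icc_right hT)
  · calc ‖S b t x‖ ≤ M * ‖x‖ :=
          ((S b t).le_opNorm x).trans (by gcongr; exact hM t ⟨ht.1, ht.2.trans hT⟩)
      _ ≤ _ := le_add_of_nonneg_right (by positivity)
  · have hts : 0 ≤ t - s := by linarith
    have e1 : 𝓑.emb hab (S b t x - S b s x) =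
        S a s (S a (t - s) (𝓑.emb hab x) - 𝓑.emb hab x) := by
      have e0 : S a t = (S a s).comp (S a (t - s)) := by
        rw [← (hE.analytic a).add s (t - s) hs.1 hts, add_sub_cancel]
      rw [map_sub, map_sub, ← hE.consistent hab t x ht.1, ← hE.consistent hab s x hs.1, e0,
        ContinuousLinearMap.comp_apply]
    rw [e1]
    calc _ ≤ M' * (C * (t - s) ^ γ * ‖x‖) := by
          refine ((S a s).le_opNorm _).trans ?_
          gcongr
          · exact hM' s ⟨hs.1, hs.2.trans hT⟩
          · exact htime (t - s) hts (by linarith [hs.1, ht.2]) x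
      _ = M' * C * ‖x‖ * (t - s) ^ γ := by ring
      _ ≤ _ := by
        gcongr
        exact le_add_of_nonneg_left (by positivity)

end Generates

variable [∀ a, CompleteSpace (B a)]

/-- Local existence and uniqueness of mild solutions driven by a path whose dyadic increments
satisfy a Hölder bound. -/
theorem exists_mildSolution (hE : 𝓑.Generates E S) {w : ℝ≥0 → ℝ} {α β γ θ η K : ℝ}
    (hγη : γ < η) (hη : η < 1) (hγη1 : 1 < γ + η) (hβ1 : β < 1) (hθγ : θ < γ) (hK : 0 ≤ K)
    (hw : DyadicHolder w η K) (hβ : α - β ≤ α) (hγ : α - γ ≤ α) (hθ : α - θ ≤ α)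
    (hγθ : α - γ - θ ≤ α - θ) {D : B α → B (α - β)} (hD : IsPolyLocallyLipschitz D)
    {F : B α → B (α - θ)} {F' : B (α - γ) → B (α - γ - θ)}
    (hFF' : ∀ x : B α, 𝓑.emb hγθ (F x) = F' (𝓑.emb hγ x)) (hF' : IsTwiceDiffBounded F')
    (hFgrowth : ∃ C : ℝ, ∀ x, ‖F x‖ ≤ C * ‖x‖)
    (hFlip : ∃ C : ℝ, ∀ x y, ‖F x - F y‖ ≤ C * ‖x - y‖) (x₀ : B α) :
    ∃ T₀ : ℝ, 0 < T₀ ∧ ∀ T : ℝ, 0 < T → T ≤ T₀ →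
      ∃ y : ℝ → B α, 𝓑.IsMildSolution S hβ hγ hθ D F w x₀ T y ∧
        ∀ y' : ℝ → B α, 𝓑.IsMildSolution S hβ hγ hθ D F w x₀ T y' → EqOn y' y (Icc 0 T) := by
  obtain ⟨C, κ, hC, hκ, hest⟩ := hE.exists_mildConvolution_estimate (hdb := hβ) (hpb := hθ) hγ hγθ
    (by ring : α - (α - γ) = γ) (by ring : α - θ - (α - γ - θ) = γ) hγη hη hγη1 (by linarith)
    (by linarith) hK hw
  obtain ⟨CF, hCF, hFV, hFV'⟩ := exists_vBound_comp (γ := γ) hγ hγθ hFF' hF' hFgrowth hFlip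
  set Ψ : (ℝ → B α) → ℝ → B α := fun y =>
    𝓑.mildConvolution S hβ hθ w (fun r => D (y r)) (fun r => F (y r)) with hΨ
  set M : (ℝ → B α) → ℝ → B α := fun y t => S α t x₀ + Ψ y t with hM
  -- the fixed point equation is the mild formulation
  have hmild : ∀ {T y}, 𝓑.IsMildSolution S hβ hγ hθ D F w x₀ T y ↔ 𝓑.MemV hγ γ T y ∧
      𝓑.IsConvolvable S hβ hθ w T (fun r => D (y r)) (fun r => F (y r)) ∧
      EqOn (M y) y (Icc 0 T) := by
    intro T y
    refine and_congr_right fun _ => ⟨fun h => ⟨fun t ht => ?_, fun t ht => ?_⟩, fun h t ht => ?_⟩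
    · obtain ⟨h1, I, h2, -⟩ := h t ht
      exact ⟨h1, I, h2⟩
    · obtain ⟨-, I, h2, h3⟩ := h t ht
      simp only [hM, hΨ, mildConvolution, h2.limUnder_eq, h3]
      abel
    · obtain ⟨h1, I, h2⟩ := h.1 t ht
      refine ⟨h1, I, h2, ?_⟩
      rw [← h.2 ht]
      simp only [hM, hΨ, mildConvolution, h2.limUnder_eq]
      abel
  have hself : ∀ R, 0 ≤ R → ∃ L, 0 ≤ L ∧ ∀ T y, 0 ≤ T → T ≤ 1 → 𝓑.VBall hγ γ T R y →
      𝓑.IsConvolvable S hβ hθ w T (fun r => D (y r)) (fun r => F (y r)) ∧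
      𝓑.VBall hγ γ T (L * T ^ κ) (Ψ y) := by
    intro R hR
    obtain ⟨CD, hCD, hDle, -⟩ := hD.exists_norm_sub_le hR
    refine ⟨C * (CD + CF * R), by positivity, fun T y hT0 hT hy => ?_⟩
    have h1 := hest (CD + CF * R) T 0 (fun r => D (y r)) (fun r => F (y r)) (by positivity) le_rfl
      hT0 hT (hD.continuous.comp_continuousOn hy.1)
      (fun r hr => (hDle _ (hy.2.1 r hr)).trans (le_add_of_nonneg_right (by positivity)))
      ((hFV T R y hR hy.2).mono le_rfl (le_add_of_nonneg_left hCD)) (by simp) (by simp)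
    rw [sub_zero] at h1
    exact ⟨h1.1, h1.2⟩
  have hcontr : ∀ R, 0 ≤ R → ∃ L, 0 ≤ L ∧ ∀ N T τ y y', 0 ≤ τ → τ ≤ T → T ≤ 1 →
      𝓑.VBall hγ γ T R y → 𝓑.VBall hγ γ T R y' → EqOn y y' (Ico 0 τ) →
      𝓑.VBound hγ γ T N (fun t => y t - y' t) →
      𝓑.VBound hγ γ T (N * (L * (T - τ) ^ κ)) (fun t => M y t - M y' t) := by
    intro R hR
    obtain ⟨CD, hCD, -, hDlip⟩ := hD.exists_norm_sub_le hR
    obtain ⟨_, _, hconv⟩ := hself R hR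
    refine ⟨C * (CD + CF * (1 + R)), by positivity, fun N T τ y y' hτ hτT hT hy hy' heq hN => ?_⟩
    have hT0 := hτ.trans hτT
    have hN0 := hN.nonneg hT0
    obtain ⟨-, -, hV⟩ := hest (CD * N + CF * (1 + R) * N) T τ (fun r => D (y r) - D (y' r))
      (fun r => F (y r) - F (y' r)) (by positivity) hτ hτT hT
      ((hD.continuous.comp_continuousOn hy.1).sub (hD.continuous.comp_continuousOn hy'.1))
      (fun r hr => by
        refine (hDlip _ _ (hy.2.1 r hr) (hy'.2.1 r hr)).trans ?_
        have := mul_le_mul_of_nonneg_left (hN.1 r hr) hCD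
        exact this.trans (le_add_of_nonneg_right (by positivity)))
      ((hFV' T R N y y' hR hN0 hy'.2 hN).mono le_rfl (le_add_of_nonneg_left (by positivity)))
      (fun r hr => by rw [heq hr, sub_self]) (fun r hr => by rw [heq hr, sub_self])
    rw [show N * (C * (CD + CF * (1 + R)) * (T - τ) ^ κ) =
      C * (CD * N + CF * (1 + R) * N) * (T - τ) ^ κ by ring]
    refine hV.congr fun t ht => ?_
    rw [hE.mildConvolution_sub hT (hconv T y hT0 hT hy).1 (hconv T y' hT0 hT hy').1 ht]
    simp only [hM, hΨ]
    abel
  obtain ⟨r, hr, horbit⟩ := hE.exists_vBall_orbit hγ (by ring : α - (α - γ) = γ) (by linarith) x₀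
  -- existence is shown in the ball of radius `r + 1`
  obtain ⟨L₁, hL₁, hself₁⟩ := hself (r + 1) (by linarith)
  obtain ⟨L₂, hL₂, hcontr₂⟩ := hcontr (r + 1) (by linarith)
  obtain ⟨T₀, hT₀, hT₀1, hsmall⟩ := exists_mul_rpow_le_half (add_nonneg hL₁ hL₂) hκ
  refine ⟨T₀, hT₀, fun T hT0 hTT₀ => ?_⟩
  have hT1 : T ≤ 1 := hTT₀.trans hT₀1
  have hTκ : 0 ≤ T ^ κ := by positivity
  have hsm := hsmall T hT0.le hTT₀
  rw [add_mul] at hsm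
  have hsm₁ : L₁ * T ^ κ ≤ 1 := by linarith [mul_nonneg hL₂ hTκ]
  have hsm₂ : L₂ * T ^ κ ≤ 1 / 2 := by linarith [mul_nonneg hL₁ hTκ]
  obtain ⟨y, hy, hfix⟩ := exists_fixedPoint (𝓑 := 𝓑) (h := hγ) (γ := γ) (R := r + 1) hT0.le M
    (fun t => S α t x₀) ⟨(horbit T hT1).1, (horbit T hT1).2.mono le_rfl (by linarith)⟩
    (fun y hy => by
      obtain ⟨-, h1⟩ := hself₁ T y hT0.le hT1 hy
      exact ⟨(horbit T hT1).1.add h1.1,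
        ((horbit T hT1).2.add h1.2).mono le_rfl (by linarith)⟩)
    (fun N y y' hy hy' hN => by
      have h1 := hcontr₂ N T 0 y y' le_rfl hT0.le hT1 hy hy' (by simp) hN
      rw [sub_zero] at h1
      refine h1.mono le_rfl ?_
      have := mul_le_mul_of_nonneg_left hsm₂ (hN.nonneg hT0.le)
      linarith)
  refine ⟨y, hmild.2 ⟨hy.memV, (hself₁ T y hT0.le hT1 hy).1, hfix⟩, fun y' hsol => ?_⟩
  obtain ⟨hV', -, hfix'⟩ := hmild.1 hsol
  obtain ⟨R', hR', hy'⟩ := hV'.exists_vBall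
  -- uniqueness is shown in a ball that contains both solutions
  set R := max (r + 1) R' with hR
  have hR0 : 0 ≤ R := hR'.trans (le_max_right _ _)
  obtain ⟨L₃, hL₃, hcontr₃⟩ := hcontr R hR0
  obtain ⟨δ, hδ, -, hδsmall⟩ := exists_mul_rpow_le_half hL₃ hκ
  have hyR : 𝓑.VBall hγ γ T R y := ⟨hy.1, hy.2.mono le_rfl (le_max_left _ _)⟩
  have hyR' : 𝓑.VBall hγ γ T R y' := ⟨hy'.1, hy'.2.mono le_rfl (le_max_right _ _)⟩
  refine eqOn_of_fixedPoint hδ M hyR' hyR hfix' hfix fun N T' τ hτ hτT' hT' hlen heq hN => ?_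
  have hsub : Icc 0 T' ⊆ Icc 0 T := Icc_subset_Icc_right hT'
  have h1 := hcontr₃ N T' τ y' y hτ hτT' (hT'.trans hT1)
    ⟨hyR'.1.mono hsub, hyR'.2.mono hT' le_rfl⟩ ⟨hyR.1.mono hsub, hyR.2.mono hT' le_rfl⟩ heq hN
  refine h1.mono le_rfl ?_
  have := mul_le_mul_of_nonneg_left (hδsmall (T' - τ) (by linarith) hlen)
    (hN.nonneg (hτ.trans hτT'))
  linarith

end InterpolationScale

theorem mainTheorem4
    {B : ℝ → Type*} [∀ a, NormedAddCommGroup (B a)] [∀ a, NormedSpace ℝ (B a)]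
    [∀ a, CompleteSpace (B a)] (𝓑 : InterpolationScale B)
    (E : ∀ a : ℝ, B (a + 1) →L[ℝ] B a) (S : ∀ a : ℝ, ℝ → B a →L[ℝ] B a)
    (hE : 𝓑.Generates E S)
    {Ω : Type*} [MeasurableSpace Ω] (P : Measure Ω) [IsProbabilityMeasure P]
    (H : ℝ) (hH : 1 / 2 < H) (hH1 : H < 1)
    (W : ℝ≥0 → Ω → ℝ) (hW : IsFractionalBrownianMotion H W P)
    (α β γ θ : ℝ) (hγ : 1 / 2 < γ) (hγH : γ < H)
    (hβ0 : 0 ≤ β) (hβ1 : β < 1) (hθ0 : 0 ≤ θ) (hθγ : θ < γ) (hθα : θ + γ < α)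
    (D : B α → B (α - β)) (hD : IsPolyLocallyLipschitz D)
    (F : B α → B (α - θ)) (F' : B (α - γ) → B (α - γ - θ))
    (hFF' : ∀ x : B α, 𝓑.emb (by linarith : α - γ - θ ≤ α - θ) (F x) =
      F' (𝓑.emb (by linarith : α - γ ≤ α) x))
    (hF : IsTwiceDiffBounded F) (hF' : IsTwiceDiffBounded F')
    (hFgrowth : ∃ C : ℝ, ∀ x, ‖F x‖ ≤ C * ‖x‖)
    (hFlip : ∃ C : ℝ, ∀ x y, ‖F x - F y‖ ≤ C * ‖x - y‖) :
    ∀ᵐ o ∂P, ∀ x₀ : B α, ∃ T₀ : ℝ, 0 < T₀ ∧ ∀ T : ℝ, 0 < T → T ≤ T₀ →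
      ∃ y : ℝ → B α,
        𝓑.IsMildSolution S (by linarith : α - β ≤ α) (by linarith : α - γ ≤ α)
          (by linarith : α - θ ≤ α) D F (fun t => W t o) x₀ T y ∧
        ∀ y' : ℝ → B α,
          𝓑.IsMildSolution S (by linarith : α - β ≤ α) (by linarith : α - γ ≤ α)
            (by linarith : α - θ ≤ α) D F (fun t => W t o) x₀ T y' →
          EqOn y' y (Icc 0 T) := by
  filter_upwards [hW.ae_exists_dyadicHolder (by linarith) (η := (γ + H) / 2) (by linarith)]
    with o ho x₀
  obtain ⟨K, hK, hw⟩ := ho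
  exact InterpolationScale.exists_mildSolution hE (by linarith) (by linarith) (by linarith) hβ1 hθγ
    hK hw _ _ _ _ hD hFF' hF' hFgrowth hFlip x₀
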